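/- **Model.** Consider a frame of $n_s\ge1$ time slots with $N_A\ge1$ active devices in the serving zone, the disk of radius $R>0$ below a UAV at altitude $h>0$. Fix a path-loss coefficient $\eta>0$, a path-loss exponent $\alpha>0$, a common transmit power $P_t>0$, a noise power $\sigma^2>0$, an SINR threshold $\theta>0$, a number $N_\nu\ge1$ of spreading codes, an average number $\lambda>0$ of packets per device, and an intensity $\omega_A>0$ of active devices. *Traffic.* The devices act independently. Each generates $L\sim\mathrm{Poisson}(\lambda)$ packets, transmits in a uniformly random set of $\min(L,n_s)$ slots (one packet per slot), and uses in each slot an independent uniformly chosen code. An active device is collision free in a slot if no other device uses the same code in that slot; $P_{CF}$ is the conditional probability that a device is collision free in a slot, given that it transmits in it. *Coverage in a slot.* Each slot contains $N_S\ge0$ collision-free (singleton) devices ($N_S$ an integer), decoded successively in the order of increasing distance. The horizontal distance $r_k$ of the $k$-th one has the law of the $k$-th smallest distance to the centre of $N_S$ independent uniform points of the disk. Its SINR is $$\gamma_k=\frac{P_t\,\eta\,(r_k^2+h^2)^{-\alpha/2}H_k}{I_S+I_C+\sigma^2},$$ where $H_k$ is exponential with mean $1$, and $I_S$, $I_C$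 are the sums of $P_t\eta(|x|^2+h^2)^{-\alpha/2}H_x$ over the singleton interferers $x$ with $|x|>r_k$ and over all the collided interferers $x$, respectively. The interferers form a homogeneous Poisson point process of intensity $\omega_A$ on the disk, whose points are independently labelled singleton with probability $P_{CF}$ and collided otherwise, and carry i.i.d. mean-$1$ exponential gains $H_x$. For each $k$, the distance $r_k$, the gain $H_k$ and the marked interferers are independent. In each slot the events $\{\gamma_k>\theta\}$, $k=1,\dots,N_S$, are assumed independent. The $k$-th singleton device is in SINR coverage if $\gamma_j>\theta$ for all $j\le k$; collided devices never are. The SINR coverage probability within the frame, $P_{succ}$, is the average probability that a transmitted packet is free of code collision and in SINR coverage, i.e. the mean number of packets of the frame that are collision free and in SINR coverage, divided by the mean number of packets generated for the frame. **Theorem.** Put $s(r)=\dfrac{\theta\,(r^2+h^2)^{\alpha/2}}{P_t\,\eta}$ and $$J(s,a)=\int_a^R\Big(1-\frac1{1+sP_t\eta(x^2+h^2)^{-\alpha/2}}\Big)x\,dx .$$ Then $$P_{succ}=\sum_{k=1}^{N_S}\frac{n_s}{N_A\lambda}\prod_{j=1}^{k}\int_0^R e^{-s(r)\sigma^2}\,e^{-2\pi\omega_AP_{CF}J(s(r),r)}\,e^{-2\pi\omega_A(1-P_{CF})J(s(r),0)}\,\frac{N_S!}{(j-1)!\,(N_S-j)!}\,\frac{2r^{2j-1}}{R^{2j}}\Big(1-\frac{r^2}{R^2}\Big)^{N_S-j}dr,$$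 where $$P_{CF}=(1-P_\lambda)^{N_A-1}+\sum_{n=1}^{N_A-1}\binom{N_A-1}{n}P_\lambda^n(1-P_\lambda)^{N_A-1-n}\Big(\frac{N_\nu-1}{N_\nu}\Big)^n,$$ $$P_\lambda=\sum_{L=1}^{n_s}\frac{e^{-\lambda}\lambda^L}{n_s\,(L-1)!}+\sum_{L=n_s+1}^{\infty}\frac{e^{-\lambda}\lambda^L}{L!}.$$ -/

import Mathlib

open MeasureTheory ProbabilityTheory

noncomputable section

namespace MusaUplink

/-- Numerical parameters of the uplink. -/
structure Params where
  /-- intensity of the Poisson process of active devices -/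
  dens : ℝ
  dens_pos : 0 < dens
  /-- radius of the serving zone -/
  radius : ℝ
  radius_pos : 0 < radius
  /-- altitude of the UAV -/
  alt : ℝ
  alt_pos : 0 < alt
  /-- path-loss coefficient -/
  coef : ℝ
  coef_pos : 0 < coef
  /-- path-loss exponent -/
  expo : ℝ
  expo_pos : 0 < expo
  /-- common transmit power of the devices -/
  power : ℝ
  power_pos : 0 < power
  /-- noise power -/
  noise : ℝ
  noise_pos : 0 < noise
  /-- SINR threshold -/
  thr : ℝ
  thr_pos : 0 < thr
  /-- average number of packets per active device and frame -/
  rate : ℝ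
  rate_pos : 0 < rate
  /-- number of time slots of the frame -/
  nSlot : ℕ
  nSlot_pos : 0 < nSlot
  /-- number of active devices of the frame -/
  nAct : ℕ
  nAct_pos : 0 < nAct
  /-- number of spreading codes -/
  nCode : ℕ
  nCode_pos : 0 < nCode
  /-- number of singleton devices per time slot -/
  nSing : ℕ

/-- The ground. The UAV hovers above the origin. -/
abbrev Plane := EuclideanSpace ℝ (Fin 2)

/-- What one active device does in a frame: the number of packets it generates, the set of slots
in which it transmits a packet, and the spreading code that it uses in each slot. -/
structure DeviceRecord (p : Params) where
  packets : ℕ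
  slots : Finset (Fin p.nSlot)
  code : Fin p.nSlot → Fin p.nCode

instance (p : Params) : MeasurableSpace (DeviceRecord p) := ⊤

/-- Probability of a record: the number of packets is Poisson; given that it equals `L`, the
device uses a uniformly random set of `min L nSlot` slots (at most one packet per slot, excess
packets are not sent); the codes are independent and uniform. -/
def recordProb (p : Params) (d : DeviceRecord p) : ℝ :=
  if d.slots.card = min d.packets p.nSlot then
    Real.exp (-p.rate) * p.rate ^ d.packets / (d.packets.factorial : ℝ)
      * (1 / ((p.nSlot.choose (min d.packets p.nSlot) : ℕ) : ℝ))
      * (1 / (p.nCode : ℝ)) ^ p.nSlot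
  else 0

/-- Received power of a unit-gain signal sent from horizontal distance `r`. -/
def pathGain (p : Params) (r : ℝ) : ℝ :=
  p.power * p.coef * (r ^ 2 + p.alt ^ 2) ^ (-p.expo / 2)

/-- The uniform distribution on the serving zone. -/
def diskUniform (p : Params) : Measure Plane :=
  ProbabilityTheory.cond volume (Metric.closedBall (0 : Plane) p.radius)

/-- The `k`-th smallest (`k = 0, 1, …`) of the distances of `n` sites from the origin. -/
def orderedDist {n : ℕ} (x : Fin n → Plane) (k : Fin n) : ℝ :=
  ‖x (Tuple.sort (fun i => ‖x i‖) k)‖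

/-- The law of the distance of the `k`-th closest of the `nSing` singleton devices, which are
independent and uniformly distributed in the serving zone. -/
def orderedDistLaw (p : Params) (k : Fin p.nSing) : Measure ℝ :=
  (Measure.pi fun _ : Fin p.nSing => diskUniform p).map fun x => orderedDist x k

/-- Law of the mark of an interferer: an exponential fading gain with unit mean and, independently,
a label, which is `true` (singleton) with probability `q` and `false` (collided) otherwise. -/
def markLaw (q : ℝ) : Measure (ℝ × Bool) :=
  (expMeasure 1).prod
    (ENNReal.ofReal q • Measure.dirac true + ENNReal.ofReal (1 - q) • Measure.dirac false)

section PointProcess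

variable {Ω : Type*} [MeasurableSpace Ω]

open Classical in
/-- The number of points in `B` of the finite point process with the `count ω` points
`pos 0 ω, …, pos (count ω - 1) ω`. -/
def pointCount (count : Ω → ℕ) (pos : ℕ → Ω → Plane) (B : Set Plane) (ω : Ω) : ℕ :=
  ((Finset.range (count ω)).filter fun i => pos i ω ∈ B).card

/-- The points form a Poisson point process with the finite intensity measure `Λ`. -/
structure IsPoissonProcess (P : Measure Ω) (Λ : Measure Plane)
    (count : Ω → ℕ) (pos : ℕ → Ω → Plane) : Prop where
  measurable_count : Measurable count
  measurable_pos : ∀ i, Measurable (pos i)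
  law_count : ∀ B : Set Plane, MeasurableSet B →
    P.map (pointCount count pos B) = poissonMeasure (Λ B).toNNReal
  indep_count : ∀ (n : ℕ) (B : Fin n → Set Plane), (∀ i, MeasurableSet (B i)) →
    Pairwise (fun i j => Disjoint (B i) (B j)) →
    iIndepFun (fun i => pointCount count pos (B i)) P

end PointProcess

/-- The random quantities of one transmission frame. In a slot, the index `k = 0, 1, …` stands for
the `(k + 1)`-th strongest singleton device in the decoding order by distance. -/
structure Frame (p : Params) (Ω : Type*) where
  /-- the record of each active device -/
  device : Fin p.nAct → Ω → DeviceRecord p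
  /-- horizontal distance of the `k`-th singleton device -/
  dist : Fin p.nSlot → Fin p.nSing → Ω → ℝ
  /-- fading gain of the `k`-th singleton device -/
  fade : Fin p.nSlot → Fin p.nSing → Ω → ℝ
  /-- number, positions and marks (fading gain, singleton label) of the potential interferers seen
  by the `k`-th singleton device -/
  count : Fin p.nSlot → Fin p.nSing → Ω → ℕ
  pos : Fin p.nSlot → Fin p.nSing → ℕ → Ω → Plane
  mark : Fin p.nSlot → Fin p.nSing → ℕ → Ω → ℝ × Bool

namespace Frame

variable {p : Params} {Ω : Type*} (F : Frame p Ω)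

/-- Device `m` transmits in slot `t`. -/
def active (m : Fin p.nAct) (t : Fin p.nSlot) : Set Ω := {ω | t ∈ (F.device m ω).slots}

/-- No other device transmits in slot `t` with the code of device `m`. -/
def collisionFree (m : Fin p.nAct) (t : Fin p.nSlot) : Set Ω :=
  {ω | ∀ m', m' ≠ m → t ∈ (F.device m' ω).slots → (F.device m' ω).code t ≠ (F.device m ω).code t}

/-- Collision free probability: the conditional probability that a device which is active in slot
`t` is collision free (the devices are exchangeable, so that any of them can serve). -/
def collisionFreeProb [MeasurableSpace Ω] (P : Measure Ω) (t : Fin p.nSlot) : ℝ :=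
  (ProbabilityTheory.cond P (F.active ⟨0, p.nAct_pos⟩ t)).real
    (F.collisionFree ⟨0, p.nAct_pos⟩ t)

open Classical in
/-- Interference at the `k`-th singleton device from the singleton devices farther away. -/
def singInterference (t : Fin p.nSlot) (k : Fin p.nSing) (ω : Ω) : ℝ :=
  ∑ i ∈ Finset.range (F.count t k ω),
    if (F.mark t k i ω).2 = true ∧ F.dist t k ω < ‖F.pos t k i ω‖ then
      pathGain p ‖F.pos t k i ω‖ * (F.mark t k i ω).1 else 0

/-- Interference at the `k`-th singleton device from all the collided devices. -/
def colInterference (t : Fin p.nSlot) (k : Fin p.nSing) (ω : Ω) : ℝ :=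
  ∑ i ∈ Finset.range (F.count t k ω),
    if (F.mark t k i ω).2 = false then
      pathGain p ‖F.pos t k i ω‖ * (F.mark t k i ω).1 else 0

/-- SINR of the `k`-th singleton device of slot `t`. -/
def sinr (t : Fin p.nSlot) (k : Fin p.nSing) (ω : Ω) : ℝ :=
  pathGain p (F.dist t k ω) * F.fade t k ω /
    (F.singInterference t k ω + F.colInterference t k ω + p.noise)

/-- The SINR of the `k`-th singleton device exceeds the threshold. -/
def exceeds (t : Fin p.nSlot) (k : Fin p.nSing) : Set Ω := {ω | p.thr < F.sinr t k ω}

/-- The `k`-th singleton device is in SINR coverage: under successive interference cancellation,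
its own SINR and those of all the stronger singleton devices exceed the threshold. -/
def covered (t : Fin p.nSlot) (k : Fin p.nSing) : Set Ω := {ω | ∀ j, j ≤ k → ω ∈ F.exceeds t j}

/-- The number of packets of the frame that are collision free and in SINR coverage. -/
def numCovered (ω : Ω) : ℝ :=
  ∑ t : Fin p.nSlot, ∑ k : Fin p.nSing, (F.covered t k).indicator (fun _ => (1 : ℝ)) ω

/-- The number of packets generated for the frame. -/
def numPackets (ω : Ω) : ℝ := ∑ m : Fin p.nAct, ((F.device m ω).packets : ℝ)

/-- SINR coverage probability within the frame: the mean number of packets that are collision free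
and in SINR coverage, per packet generated on average. -/
def coverageProb [MeasurableSpace Ω] (P : Measure Ω) : ℝ :=
  (∫ ω, F.numCovered ω ∂P) / ∫ ω, F.numPackets ω ∂P

/-- The stochastic model. Joint laws of the quantities of different singleton devices (or slots)
are not prescribed, except that in each slot the SINR coverage events are independent. -/
structure IsModel [MeasurableSpace Ω] (P : Measure Ω) : Prop where
  /-- the devices act independently, each with the law `recordProb` -/
  measurable_device : ∀ m, Measurable (F.device m)
  law_device : ∀ m d, P {ω | F.device m ω = d} = ENNReal.ofReal (recordProb p d)
  indep_device : iIndepFun F.device P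
  /-- the decoding order is by distance -/
  measurable_dist : ∀ t k, Measurable (F.dist t k)
  law_dist : ∀ t k, P.map (F.dist t k) = orderedDistLaw p k
  /-- Rayleigh fading -/
  measurable_fade : ∀ t k, Measurable (F.fade t k)
  law_fade : ∀ t k, P.map (F.fade t k) = expMeasure 1
  /-- homogeneous Poisson process of interferers in the serving zone -/
  poisson : ∀ t k, IsPoissonProcess P
    (ENNReal.ofReal p.dens • volume.restrict (Metric.closedBall (0 : Plane) p.radius))
    (F.count t k) (F.pos t k)
  /-- independent fading and independent thinning into singleton and collided interferers -/
  measurable_mark : ∀ t k i, Measurable (F.mark t k i)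
  law_mark : ∀ t k i, P.map (F.mark t k i) = markLaw (F.collisionFreeProb P t)
  indep_mark : ∀ t k, iIndepFun (F.mark t k) P
  indep_mark_points : ∀ t k,
    IndepFun (fun ω i => F.mark t k i ω) (fun ω => (F.count t k ω, fun i => F.pos t k i ω)) P
  /-- distance, fading gain and interferers of a singleton device are independent -/
  indep_dist : ∀ t k, IndepFun (F.dist t k)
    (fun ω => ((F.count t k ω, fun i => F.pos t k i ω), fun i => F.mark t k i ω)) P
  indep_fade : ∀ t k, IndepFun (F.fade t k)
    (fun ω => (F.dist t k ω,
      ((F.count t k ω, fun i => F.pos t k i ω), fun i => F.mark t k i ω))) P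
  /-- the SINR coverage events of the singleton devices of a slot are independent -/
  indep_exceeds : ∀ t, iIndepSet (F.exceeds t) P

end Frame

/-- Explicit value of the probability that a device uses a given slot. -/
def slotValue (p : Params) : ℝ :=
  (∑ L ∈ Finset.Icc 1 p.nSlot,
      Real.exp (-p.rate) * p.rate ^ L / ((p.nSlot : ℝ) * ((L - 1).factorial : ℝ)))
    + ∑' i : ℕ, Real.exp (-p.rate) * p.rate ^ (p.nSlot + 1 + i)
        / ((p.nSlot + 1 + i).factorial : ℝ)

/-- Explicit value of the collision free probability. -/
def collisionFreeValue (p : Params) : ℝ :=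
  (1 - slotValue p) ^ (p.nAct - 1)
    + ∑ n ∈ Finset.Icc 1 (p.nAct - 1), ((p.nAct - 1).choose n : ℝ) * slotValue p ^ n
        * (1 - slotValue p) ^ (p.nAct - n - 1) * (((p.nCode : ℝ) - 1) / (p.nCode : ℝ)) ^ n

/-- The Laplace variable for a singleton device at horizontal distance `r`. -/
def laplaceArg (p : Params) (r : ℝ) : ℝ :=
  p.thr * (r ^ 2 + p.alt ^ 2) ^ (p.expo / 2) / (p.power * p.coef)

/-- `∫_a^R (1 - 1 / (1 + s P η (x² + h²)^(-α/2))) x dx`. -/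
def interferenceIntegral (p : Params) (s a : ℝ) : ℝ :=
  ∫ x in a..p.radius,
    (1 - 1 / (1 + s * p.power * p.coef * (x ^ 2 + p.alt ^ 2) ^ (-p.expo / 2))) * x

end MusaUplink

end

open MusaUplink

/-!
The mean number of generated packets is `nAct * rate`, and the mean number of covered ones is the sum
over slots and singleton devices of the probabilities `P (covered t k)`. As the events `exceeds t j`
of a slot are independent, such a probability is a product of the probabilities of `exceeds t j`,
`j ≤ k`, and the theorem reduces to the evaluation of these.

The event `exceeds t j` says that the exponential gain of the device is larger than `s(r) (I + σ²)`,
where `s(r)` is `laplaceArg` and `I` the interference power. Given everything but the gain, its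
probability is `exp (-s(r) σ²) exp (-s(r) I)` (`expMeasure_exceedsSet`). The factor `exp (-s(r) I)` is
a product over the marked points: independence of the marks replaces each factor by its mean
`markedLaplace`, and the Laplace functional of the Poisson process
(`IsPoissonProcess.integral_prod`) turns the product over the points into the exponential of an
integral over the disk, which polar coordinates split into the two integrals over singleton and
collided interferers (`integral_one_sub_markedLaplace`). It remains to integrate over the distance
`r`, whose law is that of an order statistic. Its distribution function is a binomial tail in
`r² / R²`, and the derivative of a binomial tail is a single Bernstein polynomial
(`orderedDistLaw_eq_withDensity`).

The collision free probability (`IsModel.collisionFreeProb_eq`) comes from the independence of the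
devices: a device uses a given slot with a given code with probability `slotValue / nCode`, so that
the other devices all avoid the code of a given one with probability
`(1 - slotValue / nCode) ^ (nAct - 1)`, which the binomial theorem expands to `collisionFreeValue`.
-/

namespace MusaUplink

/-! ### Exponential and Poisson distributions -/

lemma expMeasure_Ioi {a : ℝ} (ha : 0 ≤ a) :
    expMeasure 1 (Set.Ioi a) = ENNReal.ofReal (Real.exp (-a)) := by
  have := isProbabilityMeasure_expMeasure one_pos
  have h := cdf_expMeasure_eq one_pos a
  rw [cdf_eq_real, if_pos ha, one_mul] at h
  rw [← ofReal_measureReal, ← Set.compl_Iic, probReal_compl_eq_one_sub measurableSet_Iic, h]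
  congr 1
  ring

lemma expMeasure_ae_nonneg : ∀ᵐ x ∂(expMeasure 1), 0 ≤ x := by
  have := isProbabilityMeasure_expMeasure one_pos
  have h : expMeasure 1 (Set.Ioi 0) = 1 := by rw [expMeasure_Ioi le_rfl]; simp
  filter_upwards [(mem_ae_iff_prob_eq_one measurableSet_Ioi).2 h] with x hx using le_of_lt hx

lemma lintegral_expMeasure_exp_neg_mul {c : ℝ} (hc : 0 ≤ c) :
    ∫⁻ x, ENNReal.ofReal (Real.exp (-(c * x))) ∂(expMeasure 1) = ENNReal.ofReal (1 / (1 + c)) := by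
  have h1 : expMeasure 1 = volume.withDensity (exponentialPDF 1) := rfl
  rw [h1, lintegral_withDensity_eq_lintegral_mul _
    (show Measurable (exponentialPDF 1) from
      (measurable_exponentialPDFReal 1).ennreal_ofReal) (by fun_prop)]
  have h2 : ∀ x, (exponentialPDF 1 * fun x => ENNReal.ofReal (Real.exp (-(c * x)))) x
      = (Set.Ici (0 : ℝ)).indicator (fun x => ENNReal.ofReal (Real.exp (-(1 + c) * x))) x := by
    intro x
    rw [Pi.mul_apply, exponentialPDF_eq]
    by_cases hx : 0 ≤ x
    · rw [if_pos hx, Set.indicator_of_mem (Set.mem_Ici.2 hx), ← ENNReal.ofReal_mul (by positivity),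
        one_mul, one_mul, ← Real.exp_add]
      ring_nf
    · rw [if_neg hx, Set.indicator_of_notMem (by simpa using hx)]
      simp
  have hneg : -(1 + c) < 0 := by linarith
  simp_rw [h2]
  rw [lintegral_indicator measurableSet_Ici, setLIntegral_congr Ioi_ae_eq_Ici.symm,
    ← ofReal_integral_eq_lintegral_ofReal (integrableOn_exp_mul_Ioi hneg 0)
      (Filter.Eventually.of_forall fun x => (Real.exp_pos _).le), integral_exp_mul_Ioi hneg]
  congr 1
  rw [mul_zero, Real.exp_zero, neg_div_neg_eq]

/-- The probability generating function of the Poisson distribution. -/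
lemma integral_pow_poissonMeasure (r : NNReal) (c : ℝ) :
    ∫ n, c ^ n ∂(poissonMeasure r) = Real.exp (-(r * (1 - c))) := by
  rw [integral_poissonMeasure]
  have h := (NormedSpace.expSeries_div_hasSum_exp (r * c : ℝ)).mul_left (Real.exp (-r))
  rw [← Real.exp_eq_exp_ℝ, ← Real.exp_add] at h
  rw [show -((r : ℝ) * (1 - c)) = -r + r * c by ring, ← h.tsum_eq]
  congr 1 with n
  simp only [smul_eq_mul, mul_pow]
  ring

lemma integral_natCast_poissonMeasure (r : NNReal) :
    ∫ n : ℕ, (n : ℝ) ∂(poissonMeasure r) = r := by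
  rw [integral_poissonMeasure]
  have h : HasSum (fun n : ℕ => (Real.exp (-r) * r ^ n / n.factorial) • (n : ℝ)) r := by
    have h1 := (hasSum_one_poissonMeasure r).mul_left (r : ℝ)
    rw [mul_one] at h1
    rw [← hasSum_nat_add_iff' 1]
    convert! h1 using 1
    · funext n
      have h2 : ((n : ℝ) + 1) ≠ 0 := by positivity
      have h3 : (n.factorial : ℝ) ≠ 0 := by positivity
      rw [Nat.factorial_succ, smul_eq_mul]
      push_cast
      field_simp
      ring
    · simp
  exact h.tsum_eq

/-! ### The Laplace functional of a Poisson process -/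

open Classical in
lemma prod_simpleFunc_eq_prod_pow_pointCount {Ω : Type*} (count : Ω → ℕ)
    (pos : ℕ → Ω → Plane) (g : SimpleFunc Plane ℝ) (ω : Ω) :
    ∏ i ∈ Finset.range (count ω), g (pos i ω)
      = ∏ c ∈ g.range, c ^ pointCount count pos (g ⁻¹' {c}) ω := by
  rw [← Finset.prod_fiberwise_of_maps_to (s := Finset.range (count ω)) (t := g.range)
    (g := fun i => g (pos i ω)) (fun i _ => g.mem_range_self _)]
  refine Finset.prod_congr rfl fun c _ => ?_
  rw [Finset.prod_congr rfl (g := fun _ => c) (fun i hi => (Finset.mem_filter.1 hi).2),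
    Finset.prod_const]
  rfl

section PoissonProcess

variable {Ω : Type*} [MeasurableSpace Ω] {P : Measure Ω} {Λ : Measure Plane}
  {count : Ω → ℕ} {pos : ℕ → Ω → Plane}

lemma measurable_finset_sum_range_comp {α β : Type*} [MeasurableSpace α] [MeasurableSpace β]
    [AddCommMonoid β] [MeasurableAdd₂ β] {N : α → ℕ} (hN : Measurable N) {f : ℕ → α → β}
    (hf : ∀ i, Measurable (f i)) : Measurable fun a => ∑ i ∈ Finset.range (N a), f i a := by
  have h : Measurable fun z : ℕ × α => ∑ i ∈ Finset.range z.1, f i z.2 :=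
    measurable_from_prod_countable_right fun n =>
      Finset.measurable_sum (Finset.range n) fun i _ => hf i
  exact h.comp (hN.prodMk measurable_id)

lemma measurable_finset_prod_range_comp {α β : Type*} [MeasurableSpace α] [MeasurableSpace β]
    [CommMonoid β] [MeasurableMul₂ β] {N : α → ℕ} (hN : Measurable N) {f : ℕ → α → β}
    (hf : ∀ i, Measurable (f i)) : Measurable fun a => ∏ i ∈ Finset.range (N a), f i a := by
  have h : Measurable fun z : ℕ × α => ∏ i ∈ Finset.range z.1, f i z.2 :=
    measurable_from_prod_countable_right fun n =>
      Finset.measurable_prod (Finset.range n) fun i _ => hf i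
  exact h.comp (hN.prodMk measurable_id)

lemma measurable_pointCount (hc : Measurable count) (hp : ∀ i, Measurable (pos i))
    {B : Set Plane} (hB : MeasurableSet B) : Measurable (pointCount count pos B) := by
  classical
  have : pointCount count pos B
      = fun ω => ∑ i ∈ Finset.range (count ω), if pos i ω ∈ B then 1 else 0 := by
    funext ω
    simp only [pointCount, Finset.card_filter]
  rw [this]
  exact measurable_finset_sum_range_comp hc fun i =>
    Measurable.ite (hp i hB) measurable_const measurable_const

/-- The level sets of a simple function are disjoint, so that the counts in them are independent
Poisson variables and the expectation is a product of generating functions. -/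
lemma IsPoissonProcess.integral_prod_simpleFunc [IsFiniteMeasure Λ]
    (h : IsPoissonProcess P Λ count pos) (g : SimpleFunc Plane ℝ) :
    ∫ ω, ∏ i ∈ Finset.range (count ω), g (pos i ω) ∂P = Real.exp (-∫ x, (1 - g x) ∂Λ) := by
  let e := g.range.equivFin
  have hmeas : ∀ i, Measurable (pointCount count pos (g ⁻¹' {((e.symm i : g.range) : ℝ)})) :=
    fun i => measurable_pointCount h.measurable_count h.measurable_pos (g.measurableSet_preimage _)
  have hind := h.indep_count _ (fun i => g ⁻¹' {((e.symm i : g.range) : ℝ)})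
    (fun i => g.measurableSet_preimage _) (fun i j hij => by
      refine Disjoint.preimage _ ?_
      rw [Set.disjoint_singleton]
      exact fun hc => hij (e.symm.injective (Subtype.ext hc)))
  have hprod : ∀ ω, ∏ i ∈ Finset.range (count ω), g (pos i ω)
      = ∏ i, ((e.symm i : g.range) : ℝ) ^ pointCount count pos
          (g ⁻¹' {((e.symm i : g.range) : ℝ)}) ω := by
    intro ω
    rw [prod_simpleFunc_eq_prod_pow_pointCount, ← Finset.prod_coe_sort, ← e.symm.prod_comp]
  simp_rw [hprod]
  rw [hind.integral_fun_prod_comp (fun i => (hmeas i).aemeasurable)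
    (f := fun i n => ((e.symm i : g.range) : ℝ) ^ n)
    (fun i => Measurable.of_discrete.aestronglyMeasurable)]
  have hterm : ∀ i, ∫ ω, ((e.symm i : g.range) : ℝ) ^ pointCount count pos
          (g ⁻¹' {((e.symm i : g.range) : ℝ)}) ω ∂P
        = Real.exp (-(Λ.real (g ⁻¹' {((e.symm i : g.range) : ℝ)})
            * (1 - ((e.symm i : g.range) : ℝ)))) := by
    intro i
    rw [← integral_map (f := fun n : ℕ => ((e.symm i : g.range) : ℝ) ^ n)
      (hmeas i).aemeasurable Measurable.of_discrete.aestronglyMeasurable,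
      h.law_count _ (g.measurableSet_preimage _), integral_pow_poissonMeasure]
    rfl
  simp_rw [hterm]
  rw [e.symm.prod_comp (fun c : g.range => Real.exp (-(Λ.real (g ⁻¹' {(c : ℝ)}) * (1 - (c : ℝ))))),
    Finset.prod_coe_sort g.range
      (fun c : ℝ => Real.exp (-(Λ.real (g ⁻¹' {c}) * (1 - c)))), ← Real.exp_sum,
    Finset.sum_neg_distrib]
  congr 2
  have hint : Integrable g Λ := g.integrable_of_isFiniteMeasure
  rw [integral_sub (integrable_const _) hint, SimpleFunc.integral_eq_sum g hint]
  simp only [mul_sub, mul_one, Finset.sum_sub_distrib, integral_const, smul_eq_mul]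
  congr 1
  have := SimpleFunc.sum_range_measure_preimage_singleton g Λ
  simp only [measureReal_def]
  rw [← this, ENNReal.toReal_sum (fun _ _ => measure_ne_top _ _)]

/-- The Laplace functional of a Poisson process, in multiplicative form. Only the laws of the counts
enter: `pos` may list the points in any order, and need not be i.i.d. given `count`. Approximation
by simple functions with values in `[0, 1]` reduces it to `integral_prod_simpleFunc`. -/
theorem IsPoissonProcess.integral_prod [IsFiniteMeasure Λ] [IsProbabilityMeasure P]
    (h : IsPoissonProcess P Λ count pos) {g : Plane → ℝ} (hg : Measurable g)
    (h01 : ∀ x, g x ∈ Set.Icc (0 : ℝ) 1) :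
    ∫ ω, ∏ i ∈ Finset.range (count ω), g (pos i ω) ∂P = Real.exp (-∫ x, (1 - g x) ∂Λ) := by
  have h0 : (0 : ℝ) ∈ Set.Icc (0 : ℝ) 1 := by simp
  -- Staying inside `[0, 1]` makes the constant `1` a dominating function on both sides.
  let G : ℕ → SimpleFunc Plane ℝ := SimpleFunc.approxOn g hg (Set.Icc 0 1) 0 h0
  have hG : ∀ n x, G n x ∈ Set.Icc (0 : ℝ) 1 := SimpleFunc.approxOn_mem hg h0
  have hlim : ∀ x, Filter.Tendsto (fun n => G n x) Filter.atTop (nhds (g x)) := fun x =>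
    SimpleFunc.tendsto_approxOn hg h0 (subset_closure (h01 x))
  have hL : Filter.Tendsto (fun n => ∫ ω, ∏ i ∈ Finset.range (count ω), G n (pos i ω) ∂P)
      Filter.atTop (nhds (∫ ω, ∏ i ∈ Finset.range (count ω), g (pos i ω) ∂P)) := by
    refine tendsto_integral_of_dominated_convergence (fun _ => 1) (fun n => ?_)
      (integrable_const _) (fun n => Filter.Eventually.of_forall fun ω => ?_)
      (Filter.Eventually.of_forall fun ω => ?_)
    · exact (measurable_finset_prod_range_comp h.measurable_count fun i =>
        (G n).measurable.comp (h.measurable_pos i)).aestronglyMeasurable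
    · rw [Real.norm_of_nonneg (Finset.prod_nonneg fun i _ => (hG n _).1)]
      exact Finset.prod_le_one (fun i _ => (hG n _).1) (fun i _ => (hG n _).2)
    · exact tendsto_finsetProd _ fun i _ => hlim _
  have hR : Filter.Tendsto (fun n => ∫ x, (1 - G n x) ∂Λ)
      Filter.atTop (nhds (∫ x, (1 - g x) ∂Λ)) := by
    refine tendsto_integral_of_dominated_convergence (fun _ => 1) (fun n => ?_)
      (integrable_const _) (fun n => Filter.Eventually.of_forall fun x => ?_)
      (Filter.Eventually.of_forall fun x => (hlim x).const_sub 1)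
    · exact (measurable_const.sub (G n).measurable).aestronglyMeasurable
    · rw [Real.norm_of_nonneg (by linarith [(hG n x).2])]
      linarith [(hG n x).1]
  simp_rw [h.integral_prod_simpleFunc] at hL
  exact tendsto_nhds_unique hL ((Real.continuous_exp.tendsto _).comp hR.neg)

end PoissonProcess

/-! ### Interference of the marked Poisson process -/

lemma sq_add_alt_sq_pos (p : Params) (r : ℝ) : 0 < r ^ 2 + p.alt ^ 2 := by
  have := p.alt_pos
  positivity

lemma pathGain_pos (p : Params) (r : ℝ) : 0 < pathGain p r := by
  have := p.power_pos
  have := p.coef_pos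
  have := sq_add_alt_sq_pos p r
  unfold pathGain
  positivity

lemma measurable_pathGain (p : Params) : Measurable (pathGain p) := by
  unfold pathGain
  fun_prop

/-- The Laplace variable is the factor by which the interference power has to be exceeded by the
fading gain. -/
lemma laplaceArg_eq_div_pathGain (p : Params) (r : ℝ) :
    laplaceArg p r = p.thr / pathGain p r := by
  have h := sq_add_alt_sq_pos p r
  have h1 := p.power_pos
  have h2 := p.coef_pos
  rw [laplaceArg, pathGain, neg_div, Real.rpow_neg h.le]
  field_simp

lemma laplaceArg_pos (p : Params) (r : ℝ) : 0 < laplaceArg p r := by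
  rw [laplaceArg_eq_div_pathGain]
  exact div_pos p.thr_pos (pathGain_pos p r)

lemma measurable_laplaceArg (p : Params) : Measurable (laplaceArg p) := by
  unfold laplaceArg
  fun_prop

open Classical in
/-- Power received from an interferer at `x` with mark `m`, while a singleton device at distance `r`
is decoded: a singleton interferer counts only if it is farther away than `r`. -/
noncomputable def interferenceTerm (p : Params) (r : ℝ) (x : Plane) (m : ℝ × Bool) : ℝ :=
  if m.2 = false ∨ r < ‖x‖ then pathGain p ‖x‖ * m.1 else 0

lemma measurable_interferenceTerm (p : Params) {α : Type*} [MeasurableSpace α] {r : α → ℝ}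
    {x : α → Plane} {m : α → ℝ × Bool} (hr : Measurable r) (hx : Measurable x) (hm : Measurable m) :
    Measurable fun a => interferenceTerm p (r a) (x a) (m a) := by
  unfold interferenceTerm
  refine Measurable.ite ?_ (((measurable_pathGain p).comp hx.norm).mul hm.fst) measurable_const
  exact ((measurableSet_singleton false).preimage hm.snd).union (measurableSet_lt hr hx.norm)

lemma interferenceTerm_nonneg (p : Params) (r : ℝ) (x : Plane) {m : ℝ × Bool} (hm : 0 ≤ m.1) :
    0 ≤ interferenceTerm p r x m := by
  unfold interferenceTerm
  split_ifs
  · exact mul_nonneg (pathGain_pos p _).le hm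
  · exact le_rfl

open Classical in
/-- The Laplace transform at `s` of the power received from an interferer at `x`, averaged over the
fading gain and the label, which is singleton with probability `q`. -/
noncomputable def markedLaplace (p : Params) (q s r : ℝ) (x : Plane) : ℝ :=
  q * (if r < ‖x‖ then 1 / (1 + s * pathGain p ‖x‖) else 1)
    + (1 - q) * (1 / (1 + s * pathGain p ‖x‖))

lemma measurable_markedLaplace (p : Params) (q s r : ℝ) : Measurable (markedLaplace p q s r) := by
  have h : Measurable fun x : Plane => 1 / (1 + s * pathGain p ‖x‖) :=
    ((((measurable_pathGain p).comp measurable_norm).const_mul s).const_add 1).const_div 1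
  unfold markedLaplace
  exact ((Measurable.ite (measurableSet_lt measurable_const measurable_norm) h
    measurable_const).const_mul q).add (h.const_mul (1 - q))

lemma one_div_one_add_mem_Icc {a : ℝ} (ha : 0 ≤ a) : 1 / (1 + a) ∈ Set.Icc (0 : ℝ) 1 :=
  ⟨by positivity, by rw [div_le_one (by positivity)]; linarith⟩

lemma markedLaplace_mem_Icc (p : Params) {q s : ℝ} (hq : q ∈ Set.Icc (0 : ℝ) 1) (hs : 0 ≤ s)
    (r : ℝ) (x : Plane) : markedLaplace p q s r x ∈ Set.Icc (0 : ℝ) 1 := by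
  have h := one_div_one_add_mem_Icc (mul_nonneg hs (pathGain_pos p ‖x‖).le)
  have h' : (if r < ‖x‖ then 1 / (1 + s * pathGain p ‖x‖) else 1) ∈ Set.Icc (0 : ℝ) 1 := by
    split_ifs
    · exact h
    · simp
  exact convex_Icc (0 : ℝ) 1 h' h hq.1 (by linarith [hq.2]) (by ring)

/-- The mark of an interferer averages to a mixture over the label of exponential Laplace
transforms. -/
lemma lintegral_markLaw (p : Params) {q s : ℝ} (hq : q ∈ Set.Icc (0 : ℝ) 1) (hs : 0 ≤ s)
    (r : ℝ) (x : Plane) :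
    ∫⁻ m, ENNReal.ofReal (Real.exp (-(s * interferenceTerm p r x m))) ∂(markLaw q)
      = ENNReal.ofReal (markedLaplace p q s r x) := by
  have := isProbabilityMeasure_expMeasure one_pos
  have hg := (pathGain_pos p ‖x‖).le
  have hF : Measurable fun m => ENNReal.ofReal (Real.exp (-(s * interferenceTerm p r x m))) :=
    ((measurable_interferenceTerm p measurable_const measurable_const
      measurable_id).const_mul s).neg.exp.ennreal_ofReal
  have h1 : ∫⁻ h, ENNReal.ofReal (Real.exp (-(s * (pathGain p ‖x‖ * h)))) ∂(expMeasure 1)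
      = ENNReal.ofReal (1 / (1 + s * pathGain p ‖x‖)) := by
    simp_rw [← mul_assoc]
    exact lintegral_expMeasure_exp_neg_mul (mul_nonneg hs hg)
  have h01 := one_div_one_add_mem_Icc (mul_nonneg hs hg)
  rw [markLaw, lintegral_prod_symm _ hF.aemeasurable, lintegral_add_measure, lintegral_smul_measure,
    lintegral_smul_measure, lintegral_dirac, lintegral_dirac, markedLaplace,
    ENNReal.ofReal_add (mul_nonneg hq.1 (by split_ifs; exacts [h01.1, zero_le_one]))
      (mul_nonneg (by linarith [hq.2]) h01.1),
    ENNReal.ofReal_mul hq.1, ENNReal.ofReal_mul (by linarith [hq.2])]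
  simp only [interferenceTerm, true_or, if_true, smul_eq_mul, h1]
  congr 2
  by_cases hx : r < ‖x‖
  · simp only [hx, or_true, if_true, h1]
  · simp [hx]

/-! ### Coverage of one singleton device -/

namespace Frame

variable {p : Params} {Ω : Type*} {F : Frame p Ω}

/-- Every interferer is either a singleton or collided, so that the two interference powers form one
sum over the marked points. -/
lemma singInterference_add_colInterference (t : Fin p.nSlot) (k : Fin p.nSing) (ω : Ω) :
    F.singInterference t k ω + F.colInterference t k ω
      = ∑ i ∈ Finset.range (F.count t k ω),
          interferenceTerm p (F.dist t k ω) (F.pos t k i ω) (F.mark t k i ω) := by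
  classical
  rw [singInterference, colInterference, ← Finset.sum_add_distrib]
  refine Finset.sum_congr rfl fun i _ => ?_
  unfold interferenceTerm
  by_cases h1 : (F.mark t k i ω).2 = false <;> by_cases h2 : F.dist t k ω < ‖F.pos t k i ω‖ <;>
    simp [h1, h2]

/-- The threshold condition on the SINR, as a set of values of the fading gain, the distance of the
device, the points and the marks of the interferers. -/
def exceedsSet (p : Params) : Set (ℝ × ℝ × (ℕ × (ℕ → Plane)) × (ℕ → ℝ × Bool)) :=
  {z | p.thr < pathGain p z.2.1 * z.1 /
    ((∑ i ∈ Finset.range z.2.2.1.1, interferenceTerm p z.2.1 (z.2.2.1.2 i) (z.2.2.2 i)) + p.noise)}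

lemma measurableSet_exceedsSet (p : Params) : MeasurableSet (exceedsSet p) := by
  refine measurableSet_lt measurable_const (Measurable.div ?_ (Measurable.add_const ?_ _))
  · exact ((measurable_pathGain p).comp measurable_snd.fst).mul measurable_fst
  · refine measurable_finset_sum_range_comp (by fun_prop) fun i => ?_
    exact measurable_interferenceTerm p (by fun_prop) (by fun_prop) (by fun_prop)

lemma exceeds_eq_preimage (t : Fin p.nSlot) (k : Fin p.nSing) :
    F.exceeds t k = (fun ω => (F.fade t k ω, F.dist t k ω,
      (F.count t k ω, fun i => F.pos t k i ω), fun i => F.mark t k i ω)) ⁻¹' exceedsSet p := by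
  ext ω
  simp only [exceeds, sinr, singInterference_add_colInterference, exceedsSet, Set.mem_ofPred_eq,
    Set.mem_preimage]

variable [MeasurableSpace Ω] {P : Measure Ω}

lemma IsModel.measurable_points (hF : F.IsModel P) (t : Fin p.nSlot) (k : Fin p.nSing) :
    Measurable fun ω => (F.count t k ω, fun i => F.pos t k i ω) :=
  (hF.poisson t k).measurable_count.prodMk
    (measurable_pi_lambda _ (hF.poisson t k).measurable_pos)

lemma IsModel.measurable_marks (hF : F.IsModel P) (t : Fin p.nSlot) (k : Fin p.nSing) :
    Measurable fun ω i => F.mark t k i ω :=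
  measurable_pi_lambda _ (hF.measurable_mark t k)

lemma IsModel.measurableSet_exceeds (hF : F.IsModel P) (t : Fin p.nSlot) (k : Fin p.nSing) :
    MeasurableSet (F.exceeds t k) := by
  rw [exceeds_eq_preimage]
  exact measurableSet_exceedsSet p |>.preimage <| (hF.measurable_fade t k).prodMk <|
    (hF.measurable_dist t k).prodMk <| (hF.measurable_points t k).prodMk (hF.measurable_marks t k)

/-- Fading gain, distance, points and marks are jointly independent. -/
lemma IsModel.map_eq_prod [IsProbabilityMeasure P] (hF : F.IsModel P) (t : Fin p.nSlot)
    (k : Fin p.nSing) :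
    P.map (fun ω => (F.fade t k ω, F.dist t k ω,
        (F.count t k ω, fun i => F.pos t k i ω), fun i => F.mark t k i ω))
      = (expMeasure 1).prod ((orderedDistLaw p k).prod
          ((P.map fun ω => (F.count t k ω, fun i => F.pos t k i ω)).prod
            (P.map fun ω i => F.mark t k i ω))) := by
  have hp := hF.measurable_points t k
  have hm := hF.measurable_marks t k
  have hd := hF.measurable_dist t k
  rw [(indepFun_iff_map_prod_eq_prod_map_map (hF.measurable_fade t k).aemeasurable
      (hd.prodMk (hp.prodMk hm)).aemeasurable).1 (hF.indep_fade t k), hF.law_fade,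
    (indepFun_iff_map_prod_eq_prod_map_map hd.aemeasurable (hp.prodMk hm).aemeasurable).1
      (hF.indep_dist t k), hF.law_dist,
    (indepFun_iff_map_prod_eq_prod_map_map hp.aemeasurable hm.aemeasurable).1
      (hF.indep_mark_points t k).symm]

lemma collisionFreeProb_mem_Icc [IsProbabilityMeasure P] (t : Fin p.nSlot) :
    F.collisionFreeProb P t ∈ Set.Icc (0 : ℝ) 1 :=
  ⟨measureReal_nonneg, measureReal_le_one⟩

lemma IsModel.ae_mark_nonneg [IsProbabilityMeasure P] (hF : F.IsModel P) (t : Fin p.nSlot)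
    (k : Fin p.nSing) : ∀ᵐ m ∂(P.map fun ω i => F.mark t k i ω), ∀ i, 0 ≤ (m i).1 := by
  have := isProbabilityMeasure_expMeasure one_pos
  refine ae_all_iff.2 fun i => ?_
  have h : ∀ᵐ m ∂(markLaw (F.collisionFreeProb P t)), 0 ≤ m.1 :=
    Measure.quasiMeasurePreserving_fst.ae expMeasure_ae_nonneg
  rw [← hF.law_mark t k i] at h
  rw [ae_map_iff (hF.measurable_marks t k).aemeasurable
    (measurableSet_le measurable_const (measurable_pi_apply i).fst)]
  exact ae_of_ae_map (hF.measurable_mark t k i).aemeasurable h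

/-- For fixed points, the independent marks average out factor by factor. -/
lemma IsModel.lintegral_marks [IsProbabilityMeasure P] (hF : F.IsModel P) (t : Fin p.nSlot)
    (k : Fin p.nSing) {s : ℝ} (hs : 0 ≤ s) (r : ℝ) (n : ℕ) (x : ℕ → Plane) :
    ∫⁻ m, ∏ i ∈ Finset.range n, ENNReal.ofReal (Real.exp (-(s * interferenceTerm p r (x i) (m i))))
        ∂(P.map fun ω i => F.mark t k i ω)
      = ∏ i ∈ Finset.range n,
          ENNReal.ofReal (markedLaplace p (F.collisionFreeProb P t) s r (x i)) := by
  have hmeas : ∀ i, Measurable fun m : ℝ × Bool =>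
      ENNReal.ofReal (Real.exp (-(s * interferenceTerm p r (x i) m))) := fun i =>
    ((measurable_interferenceTerm p measurable_const measurable_const
      measurable_id).const_mul s).neg.exp.ennreal_ofReal
  have hprod : Measurable fun m : ℕ → ℝ × Bool => ∏ i ∈ Finset.range n,
      ENNReal.ofReal (Real.exp (-(s * interferenceTerm p r (x i) (m i)))) :=
    Finset.measurable_fun_prod _ fun i _ => (hmeas i).comp (measurable_pi_apply i)
  rw [lintegral_map hprod (hF.measurable_marks t k)]
  refine (lintegral_prod_eq_prod_lintegral_of_indepFun (Finset.range n)
    (fun i ω => ENNReal.ofReal (Real.exp (-(s * interferenceTerm p r (x i) (F.mark t k i ω)))))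
    ((hF.indep_mark t k).comp _ hmeas)
    fun i => (hmeas i).comp (hF.measurable_mark t k i)).trans ?_
  refine Finset.prod_congr rfl fun i _ => ?_
  rw [← lintegral_markLaw p (collisionFreeProb_mem_Icc t) hs, ← hF.law_mark t k i,
    lintegral_map (hmeas i) (hF.measurable_mark t k i)]

/-- The intensity measure of the interferers. -/
noncomputable abbrev intensity (p : Params) : Measure Plane :=
  ENNReal.ofReal p.dens • volume.restrict (Metric.closedBall (0 : Plane) p.radius)

instance (p : Params) : IsFiniteMeasure (intensity p) := by
  have : IsFiniteMeasure (volume.restrict (Metric.closedBall (0 : Plane) p.radius)) :=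
    ⟨by rw [Measure.restrict_apply_univ]; exact measure_closedBall_lt_top⟩
  exact Measure.smul_finite _ ENNReal.ofReal_ne_top

lemma IsModel.lintegral_points [IsProbabilityMeasure P] (hF : F.IsModel P) (t : Fin p.nSlot)
    (k : Fin p.nSing) {q s : ℝ} (hq : q ∈ Set.Icc (0 : ℝ) 1) (hs : 0 ≤ s) (r : ℝ) :
    ∫⁻ a, ∏ i ∈ Finset.range a.1, ENNReal.ofReal (markedLaplace p q s r (a.2 i))
        ∂(P.map fun ω => (F.count t k ω, fun i => F.pos t k i ω))
      = ENNReal.ofReal (Real.exp (-∫ x, (1 - markedLaplace p q s r x) ∂(intensity p))) := by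
  have hg := measurable_markedLaplace p q s r
  have h01 := markedLaplace_mem_Icc p hq hs r
  have hprod : Measurable fun a : ℕ × (ℕ → Plane) =>
      ∏ i ∈ Finset.range a.1, ENNReal.ofReal (markedLaplace p q s r (a.2 i)) :=
    measurable_finset_prod_range_comp measurable_fst fun i =>
      (hg.comp (measurable_pi_apply i |>.comp measurable_snd)).ennreal_ofReal
  rw [lintegral_map hprod (hF.measurable_points t k),
    ← (hF.poisson t k).integral_prod hg h01, ofReal_integral_eq_lintegral_ofReal]
  · refine lintegral_congr fun ω => ?_
    rw [ENNReal.ofReal_prod_of_nonneg fun i _ => (h01 _).1]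
  · refine Integrable.of_bound (C := 1) (measurable_finset_prod_range_comp
      (hF.poisson t k).measurable_count fun i =>
        hg.comp ((hF.poisson t k).measurable_pos i)).aestronglyMeasurable
      (Filter.Eventually.of_forall fun ω => ?_)
    rw [Real.norm_of_nonneg (Finset.prod_nonneg fun i _ => (h01 _).1)]
    exact Finset.prod_le_one (fun i _ => (h01 _).1) (fun i _ => (h01 _).2)
  · exact Filter.Eventually.of_forall fun ω => Finset.prod_nonneg fun i _ => (h01 _).1

/-- Rayleigh fading turns the coverage event into a Laplace transform: for nonnegative fading gains
of the interferers, the conditional probability of coverage is an exponential of the interference. -/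
lemma expMeasure_exceedsSet (r : ℝ) (n : ℕ) (x : ℕ → Plane) {m : ℕ → ℝ × Bool}
    (hm : ∀ i, 0 ≤ (m i).1) :
    expMeasure 1 ((fun h => (h, r, (n, x), m)) ⁻¹' exceedsSet p)
      = ENNReal.ofReal (Real.exp (-(laplaceArg p r * p.noise))) * ∏ i ∈ Finset.range n,
          ENNReal.ofReal (Real.exp (-(laplaceArg p r * interferenceTerm p r (x i) (m i)))) := by
  set I := ∑ i ∈ Finset.range n, interferenceTerm p r (x i) (m i) with hI
  have hI0 : 0 ≤ I := Finset.sum_nonneg fun i _ => interferenceTerm_nonneg p r _ (hm i)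
  have hN : 0 < I + p.noise := add_pos_of_nonneg_of_pos hI0 p.noise_pos
  have hg := pathGain_pos p r
  have hset : (fun h => (h, r, (n, x), m)) ⁻¹' exceedsSet p
      = Set.Ioi (laplaceArg p r * (I + p.noise)) := by
    ext h
    rw [laplaceArg_eq_div_pathGain]
    simp only [exceedsSet, Set.mem_preimage, Set.mem_ofPred_eq, Set.mem_Ioi, ← hI]
    rw [lt_div_iff₀ hN, div_mul_eq_mul_div, div_lt_iff₀ hg, mul_comm h]
  rw [hset, expMeasure_Ioi (mul_nonneg (laplaceArg_pos p r).le hN.le),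
    ← ENNReal.ofReal_prod_of_nonneg fun i _ => (Real.exp_pos _).le,
    ← ENNReal.ofReal_mul (Real.exp_pos _).le, ← Real.exp_sum, ← Real.exp_add,
    Finset.sum_neg_distrib, ← Finset.mul_sum]
  congr 2
  ring

/-- Integrating out, in turn, the fading gain, the marks and the points leaves an integral over the
distance of the device. -/
lemma IsModel.measure_exceeds [IsProbabilityMeasure P] (hF : F.IsModel P) (t : Fin p.nSlot)
    (k : Fin p.nSing) :
    P (F.exceeds t k) = ∫⁻ r, ENNReal.ofReal (Real.exp (-(laplaceArg p r * p.noise)) *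
      Real.exp (-∫ x, (1 - markedLaplace p (F.collisionFreeProb P t) (laplaceArg p r) r x)
        ∂(intensity p))) ∂(orderedDistLaw p k) := by
  have := isProbabilityMeasure_expMeasure one_pos
  have hm := hF.measurable_marks t k
  have hp := hF.measurable_points t k
  have := Measure.isProbabilityMeasure_map (μ := P) hm.aemeasurable
  have := Measure.isProbabilityMeasure_map (μ := P) hp.aemeasurable
  have : IsProbabilityMeasure (orderedDistLaw p k) := by
    rw [← hF.law_dist t k]
    exact Measure.isProbabilityMeasure_map (hF.measurable_dist t k).aemeasurable
  have hS := measurableSet_exceedsSet p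
  have hmeas := measurable_measure_prodMk_right (μ := expMeasure 1) hS
  rw [exceeds_eq_preimage, ← Measure.map_apply ((hF.measurable_fade t k).prodMk <|
    (hF.measurable_dist t k).prodMk <| hp.prodMk hm) hS, hF.map_eq_prod,
    Measure.prod_apply_symm hS, lintegral_prod _ hmeas.aemeasurable]
  refine lintegral_congr fun r => ?_
  have hs := (laplaceArg_pos p r).le
  have hmeas' : Measurable fun y => expMeasure 1 ((fun h => (h, r, y)) ⁻¹' exceedsSet p) :=
    hmeas.comp (measurable_const.prodMk measurable_id)
  rw [lintegral_prod _ hmeas'.aemeasurable,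
    ENNReal.ofReal_mul (Real.exp_pos _).le,
    ← hF.lintegral_points t k (collisionFreeProb_mem_Icc t) hs,
    ← lintegral_const_mul' _ _ ENNReal.ofReal_ne_top]
  refine lintegral_congr fun a => ?_
  rw [← hF.lintegral_marks t k hs, ← lintegral_const_mul' _ _ ENNReal.ofReal_ne_top]
  refine lintegral_congr_ae ?_
  filter_upwards [hF.ae_mark_nonneg t k] with m hm0
  exact expMeasure_exceedsSet r a.1 a.2 hm0

end Frame

/-! ### Radial integrals over the serving zone -/

/-- Polar coordinates. No integrability is needed, since both sides are zero without it. -/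
lemma setIntegral_closedBall_norm (f : ℝ → ℝ) {R : ℝ} (hR : 0 ≤ R) :
    ∫ x in Metric.closedBall (0 : Plane) R, f ‖x‖ = 2 * Real.pi * ∫ y in (0 : ℝ)..R, f y * y := by
  have h1 : (Metric.closedBall (0 : Plane) R).indicator (fun x => f ‖x‖)
      = fun x => (Set.Iic R).indicator f ‖x‖ := by
    funext x
    simp only [Set.indicator, mem_closedBall_zero_iff, Set.mem_Iic]
  have h2 : volume.real (Metric.ball (0 : Plane) 1) = Real.pi := by
    rw [measureReal_def, EuclideanSpace.volume_ball_fin_two]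
    simp [Real.pi_pos.le]
  have h3 : ∀ y : ℝ, y ^ (2 - 1) • (Set.Iic R).indicator f y
      = (Set.Iic R).indicator (fun y => f y * y) y := by
    intro y
    by_cases hy : y ∈ Set.Iic R
    · simp [Set.indicator_of_mem hy, mul_comm]
    · simp [Set.indicator_of_notMem hy]
  rw [← integral_indicator Metric.isClosed_closedBall.measurableSet, h1,
    integral_fun_norm_addHaar, finrank_euclideanSpace_fin, h2, intervalIntegral.integral_of_le hR]
  simp_rw [h3]
  rw [setIntegral_indicator measurableSet_Iic, Set.Ioi_inter_Iic]
  simp only [nsmul_eq_mul, smul_eq_mul, Nat.cast_ofNat]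
  ring

lemma interferenceIntegral_eq (p : Params) (s a : ℝ) :
    interferenceIntegral p s a = ∫ x in a..p.radius, (1 - 1 / (1 + s * pathGain p x)) * x := by
  simp only [interferenceIntegral, pathGain, mul_assoc]

lemma continuous_interference_integrand (p : Params) {s : ℝ} (hs : 0 ≤ s) :
    Continuous fun x : ℝ => (1 - 1 / (1 + s * pathGain p x)) * x := by
  have h : Continuous (pathGain p) := by
    unfold pathGain
    exact continuous_const.mul (Continuous.rpow_const (by fun_prop)
      fun x => Or.inl (sq_add_alt_sq_pos p x).ne')
  refine (continuous_const.sub (continuous_const.div (by fun_prop) fun x => ?_)).mul continuous_id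
  have := mul_nonneg hs (pathGain_pos p x).le
  positivity

/-- The exponent of the Laplace functional: singleton interferers count from distance `r` on,
collided ones from the centre. -/
lemma integral_one_sub_markedLaplace (p : Params) (q : ℝ) {s r : ℝ} (hs : 0 ≤ s)
    (hr : r ∈ Set.Icc 0 p.radius) :
    ∫ x, (1 - markedLaplace p q s r x) ∂(Frame.intensity p)
      = 2 * Real.pi * p.dens * q * interferenceIntegral p s r
        + 2 * Real.pi * p.dens * (1 - q) * interferenceIntegral p s 0 := by
  classical
  set φ : ℝ → ℝ := fun x => (1 - 1 / (1 + s * pathGain p x)) * x with hφ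
  have hc : Continuous φ := continuous_interference_integrand p hs
  have hind : ∫ y in (0 : ℝ)..p.radius, (Set.Ioi r).indicator φ y = ∫ y in r..p.radius, φ y := by
    rw [intervalIntegral.integral_of_le p.radius_pos.le, intervalIntegral.integral_of_le hr.2,
      setIntegral_indicator measurableSet_Ioi]
    congr 2
    ext y
    simp only [Set.mem_inter_iff, Set.mem_Ioc, Set.mem_Ioi]
    exact ⟨fun h => ⟨h.2, h.1.2⟩, fun h => ⟨⟨hr.1.trans_lt h.1, h.2⟩, h.1⟩⟩
  have hsplit : ∀ y : ℝ, (1 - (q * (if r < y then 1 / (1 + s * pathGain p y) else 1)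
      + (1 - q) * (1 / (1 + s * pathGain p y)))) * y
      = q * (Set.Ioi r).indicator φ y + (1 - q) * φ y := by
    intro y
    by_cases hy : r < y
    · rw [Set.indicator_of_mem (Set.mem_Ioi.2 hy), if_pos hy]
      ring
    · rw [Set.indicator_of_notMem (by simpa using hy), if_neg hy]
      ring
  have hi : IntervalIntegrable ((Set.Ioi r).indicator φ) volume 0 p.radius := by
    have := (hc.intervalIntegrable (μ := volume) 0 p.radius)
    exact ⟨this.1.indicator measurableSet_Ioi, this.2.indicator measurableSet_Ioi⟩
  have key := setIntegral_closedBall_norm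
    (fun y => 1 - (q * (if r < y then 1 / (1 + s * pathGain p y) else 1)
      + (1 - q) * (1 / (1 + s * pathGain p y)))) p.radius_pos.le
  simp_rw [hsplit] at key
  rw [intervalIntegral.integral_add (hi.const_mul q) ((hc.intervalIntegrable _ _).const_mul _),
    intervalIntegral.integral_const_mul, intervalIntegral.integral_const_mul, hind] at key
  rw [interferenceIntegral_eq, interferenceIntegral_eq, integral_smul_measure,
    ENNReal.toReal_ofReal p.dens_pos.le, smul_eq_mul]
  unfold markedLaplace
  rw [key]
  ring

/-! ### Order statistics of the distances -/

section OrderStatistics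

open Classical in
/-- Probability that more than `k` of `n` independent events of probability `u` occur. -/
noncomputable def binomialTail (n k : ℕ) (u : ℝ) : ℝ :=
  ∑ m ∈ Finset.range (n + 1), n.choose m • (if k < m then u ^ m * (1 - u) ^ (n - m) else 0)

lemma binomialTail_zero (n k : ℕ) : binomialTail n k 0 = 0 := by
  refine Finset.sum_eq_zero fun m _ => ?_
  split_ifs with h
  · rw [zero_pow (by omega)]
    simp
  · simp

lemma binomialTail_eq_sum_bernsteinPolynomial (n k : ℕ) (u : ℝ) :
    binomialTail n k u = ∑ ν ∈ Finset.Ico k n, (bernsteinPolynomial ℝ n (ν + 1)).eval u := by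
  have h : Finset.Ico (k + 1) (n + 1) = (Finset.range (n + 1)).filter (k < ·) := by
    ext m
    simp only [Finset.mem_Ico, Finset.mem_filter, Finset.mem_range]
    omega
  rw [Finset.sum_Ico_add' (fun m => (bernsteinPolynomial ℝ n m).eval u) k n 1, h,
    Finset.sum_filter, binomialTail]
  refine Finset.sum_congr rfl fun m _ => ?_
  split_ifs
  · simp [bernsteinPolynomial, mul_assoc]
  · simp

/-- The derivative of the binomial tail telescopes to a single Bernstein polynomial. -/
lemma hasDerivAt_binomialTail {n k : ℕ} (hk : k < n) (u : ℝ) :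
    HasDerivAt (binomialTail n k) ((n.factorial : ℝ) / (k.factorial * (n - (k + 1)).factorial)
      * u ^ k * (1 - u) ^ (n - (k + 1))) u := by
  have h1 : binomialTail n k
      = fun u => (∑ ν ∈ Finset.Ico k n, bernsteinPolynomial ℝ n (ν + 1)).eval u := by
    funext u
    rw [binomialTail_eq_sum_bernsteinPolynomial, Polynomial.eval_finsetSum]
  rw [h1]
  convert! Polynomial.hasDerivAt (∑ ν ∈ Finset.Ico k n, bernsteinPolynomial ℝ n (ν + 1)) u using 1
  obtain ⟨N, rfl⟩ : ∃ N, n = N + 1 := ⟨n - 1, by omega⟩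
  have h2 : Polynomial.derivative (∑ ν ∈ Finset.Ico k (N + 1), bernsteinPolynomial ℝ (N + 1) (ν + 1))
      = ((N + 1 : ℕ) : Polynomial ℝ) * bernsteinPolynomial ℝ N k := by
    rw [Polynomial.derivative_sum]
    simp_rw [bernsteinPolynomial.derivative_succ, Nat.add_sub_cancel]
    rw [← Finset.mul_sum]
    have h3 := Finset.sum_Ico_sub (fun ν => bernsteinPolynomial ℝ N ν) hk.le
    have h4 : bernsteinPolynomial ℝ N (N + 1) = 0 :=
      bernsteinPolynomial.eq_zero_of_lt ℝ (Nat.lt_succ_self N)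
    rw [h4, zero_sub] at h3
    rw [← neg_neg (bernsteinPolynomial ℝ N k), ← h3, ← Finset.sum_neg_distrib]
    simp only [neg_sub]
  have hkN : k ≤ N := by omega
  rw [h2, bernsteinPolynomial, Nat.add_sub_add_right]
  simp only [Polynomial.eval_mul, Polynomial.eval_natCast, Polynomial.eval_pow, Polynomial.eval_X,
    Polynomial.eval_sub, Polynomial.eval_one]
  rw [Nat.cast_choose ℝ hkN, Nat.factorial_succ]
  push_cast
  ring

variable {n : ℕ}

/-- The `k`-th order statistic (counted from `0`) is at most `a` iff more than `k` distances are. -/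
lemma orderedDist_le_iff (x : Fin n → Plane) (k : Fin n) (a : ℝ) :
    orderedDist x k ≤ a ↔ (k : ℕ) < (Finset.univ.filter fun i => ‖x i‖ ≤ a).card := by
  have hmono := Tuple.monotone_sort fun i => ‖x i‖
  have h := Tuple.lt_card_le_iff_apply_le_of_monotone (j := k) (a := a) hmono
  have hcard : (Finset.univ.filter fun i => ((fun i => ‖x i‖) ∘ Tuple.sort fun i => ‖x i‖) i ≤ a).card
      = (Finset.univ.filter fun i => ‖x i‖ ≤ a).card := by
    refine Finset.card_equiv (Tuple.sort fun i => ‖x i‖) fun i => ?_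
    simp
  rw [hcard] at h
  exact h.symm

open Classical in
lemma filter_mem_eq_preimage {A : Set Plane} (S : Finset (Fin n)) :
    (fun x : Fin n → Plane => Finset.univ.filter fun i => x i ∈ A) ⁻¹' {S}
      = Set.univ.pi fun i => if i ∈ S then A else Aᶜ := by
  ext x
  simp only [Set.mem_preimage, Set.mem_singleton_iff, Finset.ext_iff, Finset.mem_filter,
    Finset.mem_univ, true_and, Set.mem_pi, Set.mem_univ, forall_const]
  refine forall_congr' fun i => ?_
  by_cases hi : i ∈ S <;> simp [hi]

open Classical in
/-- The number of points in `A` among `n` independent points is binomial: each set of indices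
contributes a box. -/
lemma pi_card_filter_mem (μ : Measure Plane) [IsProbabilityMeasure μ] {A : Set Plane}
    (hA : MeasurableSet A) (k : ℕ) :
    (Measure.pi fun _ : Fin n => μ) {x | k < (Finset.univ.filter fun i => x i ∈ A).card}
      = ENNReal.ofReal (binomialTail n k (μ.real A)) := by
  have hset : {x : Fin n → Plane | k < (Finset.univ.filter fun i => x i ∈ A).card}
      = (fun x : Fin n → Plane => Finset.univ.filter fun i => x i ∈ A) ⁻¹'
        ↑(Finset.univ.powerset.filter fun S : Finset (Fin n) => k < S.card) := by
    ext x
    simp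
  have hbox : ∀ S : Finset (Fin n), (Measure.pi fun _ : Fin n => μ)
      ((fun x : Fin n → Plane => Finset.univ.filter fun i => x i ∈ A) ⁻¹' {S})
      = ENNReal.ofReal (μ.real A ^ S.card * (1 - μ.real A) ^ (n - S.card)) := by
    intro S
    rw [filter_mem_eq_preimage, Measure.pi_pi]
    have h1 : ∀ i, μ (if i ∈ S then A else Aᶜ)
        = ENNReal.ofReal (if i ∈ S then μ.real A else 1 - μ.real A) := by
      intro i
      split_ifs
      · exact (ofReal_measureReal).symm
      · rw [← probReal_compl_eq_one_sub hA, ofReal_measureReal]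
    have h2 : ∀ i, 0 ≤ (if i ∈ S then μ.real A else 1 - μ.real A) := by
      intro i
      split_ifs
      · exact measureReal_nonneg
      · linarith [measureReal_le_one (μ := μ) (s := A)]
    simp_rw [h1]
    rw [← ENNReal.ofReal_prod_of_nonneg fun i _ => h2 i, Finset.prod_ite]
    simp [Finset.filter_not, Finset.card_sdiff]
  rw [hset, ← sum_measure_preimage_singleton]
  · simp_rw [hbox]
    rw [← ENNReal.ofReal_sum_of_nonneg]
    · rw [Finset.sum_filter, Finset.sum_powerset_apply_card (fun m =>
        if k < m then μ.real A ^ m * (1 - μ.real A) ^ (n - m) else 0), Finset.card_univ,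
        Fintype.card_fin]
      rfl
    · intro S _
      have := measureReal_le_one (μ := μ) (s := A)
      exact mul_nonneg (pow_nonneg measureReal_nonneg _) (pow_nonneg (by linarith) _)
  · intro S _
    rw [filter_mem_eq_preimage]
    exact MeasurableSet.univ_pi fun i => by split_ifs; exacts [hA, hA.compl]

lemma measurable_orderedDist (k : Fin n) : Measurable fun x : Fin n → Plane => orderedDist x k := by
  refine measurable_of_Iic fun a => ?_
  have h : (fun x : Fin n → Plane => orderedDist x k) ⁻¹' Set.Iic a
      = {x | (k : ℕ) < ∑ i, if ‖x i‖ ≤ a then 1 else 0} := by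
    ext x
    simp [orderedDist_le_iff]
  rw [h]
  refine measurableSet_lt measurable_const (Finset.measurable_sum _ fun i _ => ?_)
  exact Measurable.ite (measurableSet_le (measurable_pi_apply i).norm measurable_const)
    measurable_const measurable_const

end OrderStatistics

instance (p : Params) : IsProbabilityMeasure (diskUniform p) :=
  cond_isProbabilityMeasure_of_finite (Metric.measure_closedBall_pos _ _ p.radius_pos).ne'
    measure_closedBall_lt_top.ne

lemma diskUniform_real_norm_le (p : Params) (a : ℝ) :
    (diskUniform p).real {x | ‖x‖ ≤ a} = (max 0 (min a p.radius)) ^ 2 / p.radius ^ 2 := by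
  have hR := p.radius_pos
  have hvol : ∀ b : ℝ, 0 ≤ b →
      (volume (Metric.closedBall (0 : Plane) b)).toReal = b ^ 2 * Real.pi := by
    intro b hb
    rw [EuclideanSpace.volume_closedBall_fin_two]
    simp [hb, Real.pi_pos.le]
  have hset : {x : Plane | ‖x‖ ≤ a} = Metric.closedBall 0 a := by
    ext x
    simp
  rw [diskUniform, measureReal_def, cond_apply Metric.isClosed_closedBall.measurableSet, hset,
    ENNReal.toReal_mul, ENNReal.toReal_inv, hvol _ hR.le]
  have hinter : Metric.closedBall (0 : Plane) p.radius ∩ Metric.closedBall 0 a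
      = Metric.closedBall 0 (min a p.radius) := by
    ext x
    simp [and_comm]
  rw [hinter]
  rcases le_or_gt 0 a with ha | ha
  · have hb : 0 ≤ min a p.radius := le_min ha hR.le
    rw [hvol _ hb, max_eq_right hb]
    field_simp
  · have hb : min a p.radius < 0 := min_lt_of_left_lt ha
    rw [Metric.closedBall_eq_empty.2 hb, max_eq_left hb.le]
    simp

/-- Density on `(0, R]` of the distance of the `j`-th closest singleton device, counted from
`j = 1`. -/
noncomputable def orderedDistDensity (p : Params) (j : ℕ) (r : ℝ) : ℝ :=
  (p.nSing.factorial : ℝ) / (((j - 1).factorial : ℝ) * ((p.nSing - j).factorial : ℝ))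
    * (2 * r ^ (2 * j - 1) / p.radius ^ (2 * j)) * (1 - r ^ 2 / p.radius ^ 2) ^ (p.nSing - j)

lemma continuous_orderedDistDensity (p : Params) (j : ℕ) : Continuous (orderedDistDensity p j) := by
  unfold orderedDistDensity
  fun_prop

lemma orderedDistDensity_nonneg (p : Params) (j : ℕ) {r : ℝ} (hr : r ∈ Set.Icc 0 p.radius) :
    0 ≤ orderedDistDensity p j r := by
  have hR := p.radius_pos
  have h0 := hr.1
  have h1 : 0 ≤ 1 - r ^ 2 / p.radius ^ 2 := by
    rw [sub_nonneg, div_le_one (by positivity)]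
    exact pow_le_pow_left₀ h0 hr.2 2
  unfold orderedDistDensity
  positivity

lemma integral_orderedDistDensity (p : Params) (k : Fin p.nSing) (b : ℝ) :
    ∫ r in (0 : ℝ)..b, orderedDistDensity p (k + 1) r
      = binomialTail p.nSing k (b ^ 2 / p.radius ^ 2) := by
  have hR := p.radius_pos
  have hderiv : ∀ r, HasDerivAt (fun r => binomialTail p.nSing k (r ^ 2 / p.radius ^ 2))
      (orderedDistDensity p (k + 1) r) r := by
    intro r
    have h1 : HasDerivAt (fun r : ℝ => r ^ 2 / p.radius ^ 2) (2 * r / p.radius ^ 2) r := by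
      simpa using (hasDerivAt_pow 2 r).div_const (p.radius ^ 2)
    convert! (hasDerivAt_binomialTail k.2 (r ^ 2 / p.radius ^ 2)).comp r h1 using 1
    rw [orderedDistDensity, Nat.add_sub_cancel, show 2 * ((k : ℕ) + 1) - 1 = 2 * k + 1 by omega,
      div_pow, ← pow_mul, ← pow_mul, show 2 * ((k : ℕ) + 1) = 2 * k + 2 by ring]
    field_simp
    ring
  rw [intervalIntegral.integral_eq_sub_of_hasDerivAt (fun r _ => hderiv r)
    ((continuous_orderedDistDensity p _).intervalIntegrable _ _)]
  simp [binomialTail_zero]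

instance (p : Params) (k : Fin p.nSing) : IsProbabilityMeasure (orderedDistLaw p k) :=
  Measure.isProbabilityMeasure_map (measurable_orderedDist k).aemeasurable

/-- The law of the `k`-th order statistic has the density `orderedDistDensity`: the distribution
functions agree, that of the order statistic being a binomial tail in `r² / R²`. -/
theorem orderedDistLaw_eq_withDensity (p : Params) (k : Fin p.nSing) :
    orderedDistLaw p k = (volume.restrict (Set.Ioc 0 p.radius)).withDensity
      fun r => ENNReal.ofReal (orderedDistDensity p (k + 1) r) := by
  classical
  refine Measure.ext_of_Iic _ _ fun a => ?_
  -- `b` clamps `a` to `[0, R]`, which treats the three ranges of `a` at once.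
  set b := max 0 (min a p.radius) with hb
  have hb0 : 0 ≤ b := le_max_left _ _
  have hbR : b ≤ p.radius := max_le p.radius_pos.le (min_le_right _ _)
  have hset : Set.Iic a ∩ Set.Ioc 0 p.radius = Set.Ioc 0 b := by
    ext r
    simp only [hb, Set.mem_inter_iff, Set.mem_Iic, Set.mem_Ioc, le_max_iff, le_min_iff]
    constructor
    · rintro ⟨h1, h2, h3⟩
      exact ⟨h2, Or.inr ⟨h1, h3⟩⟩
    · rintro ⟨h2, h | h⟩
      · exact absurd h h2.not_ge
      · exact ⟨h.1, h2, h.2⟩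
  rw [withDensity_apply _ measurableSet_Iic, Measure.restrict_restrict measurableSet_Iic, hset,
    ← ofReal_integral_eq_lintegral_ofReal
      ((continuous_orderedDistDensity p _).integrableOn_Ioc)
      ((ae_restrict_mem measurableSet_Ioc).mono fun r hr =>
        orderedDistDensity_nonneg p _ ⟨hr.1.le, hr.2.trans hbR⟩),
    ← intervalIntegral.integral_of_le hb0, integral_orderedDistDensity, hb,
    ← diskUniform_real_norm_le, ← pi_card_filter_mem _
      (measurableSet_le measurable_norm measurable_const), orderedDistLaw,
    Measure.map_apply (measurable_orderedDist k) measurableSet_Iic]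
  congr 1
  ext x
  simp only [Set.mem_preimage, Set.mem_Iic, orderedDist_le_iff, Set.mem_ofPred_eq]

/-- The coverage probability of one singleton device, before the collision free probability is
evaluated. -/
theorem Frame.IsModel.real_exceeds {p : Params} {Ω : Type*} {F : Frame p Ω} [MeasurableSpace Ω]
    {P : Measure Ω} [IsProbabilityMeasure P] (hF : F.IsModel P) (t : Fin p.nSlot)
    (k : Fin p.nSing) :
    P.real (F.exceeds t k) = ∫ r in (0 : ℝ)..p.radius,
      Real.exp (-(laplaceArg p r * p.noise))
      * Real.exp (-(2 * Real.pi * p.dens * F.collisionFreeProb P t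
          * interferenceIntegral p (laplaceArg p r) r))
      * Real.exp (-(2 * Real.pi * p.dens * (1 - F.collisionFreeProb P t)
          * interferenceIntegral p (laplaceArg p r) 0))
      * orderedDistDensity p (k + 1) r := by
  set q := F.collisionFreeProb P t
  let G : ℝ → ℝ := fun r => Real.exp (-(laplaceArg p r * p.noise)) *
      Real.exp (-∫ x, (1 - markedLaplace p q (laplaceArg p r) r x) ∂(intensity p))
  -- `G` contains an integral that depends on `r` also through the region `r < ‖x‖`.
  have hG : Measurable G := by
    have h1 : Measurable fun z : ℝ × Plane =>
        1 / (1 + laplaceArg p z.1 * pathGain p ‖z.2‖) :=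
      ((((measurable_laplaceArg p).comp measurable_fst).mul
        ((measurable_pathGain p).comp measurable_snd.norm)).const_add 1).const_div 1
    have h2 : Measurable fun z : ℝ × Plane =>
        1 - markedLaplace p q (laplaceArg p z.1) z.1 z.2 := by
      unfold markedLaplace
      exact (((Measurable.ite (measurableSet_lt measurable_fst measurable_snd.norm) h1
        measurable_const).const_mul q).add (h1.const_mul (1 - q))).const_sub 1
    have h3 := (h2.stronglyMeasurable.integral_prod_right' (ν := intensity p)).measurable
    exact (((measurable_laplaceArg p).mul_const _).neg.exp).mul h3.neg.exp
  have hf := continuous_orderedDistDensity p (k + 1)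
  rw [measureReal_def, hF.measure_exceeds, orderedDistLaw_eq_withDensity,
    lintegral_withDensity_eq_lintegral_mul _ hf.measurable.ennreal_ofReal hG.ennreal_ofReal,
    intervalIntegral.integral_of_le p.radius_pos.le]
  have hnn : 0 ≤ᵐ[volume.restrict (Set.Ioc 0 p.radius)]
      fun r => G r * orderedDistDensity p (k + 1) r :=
    (ae_restrict_mem measurableSet_Ioc).mono fun r hr =>
      mul_nonneg (mul_pos (Real.exp_pos _) (Real.exp_pos _)).le
        (orderedDistDensity_nonneg p _ ⟨hr.1.le, hr.2⟩)
  have h := integral_eq_lintegral_of_nonneg_ae hnn (hG.mul hf.measurable).aestronglyMeasurable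
  rw [setIntegral_congr_fun measurableSet_Ioc (g := fun r => G r * orderedDistDensity p (k + 1) r)
    fun r hr => ?_, h]
  · congr 1
    refine lintegral_congr fun r => ?_
    rw [mul_comm, ENNReal.ofReal_mul (mul_pos (Real.exp_pos _) (Real.exp_pos _)).le]
    rfl
  · simp only [G]
    rw [integral_one_sub_markedLaplace p q (laplaceArg_pos p r).le ⟨hr.1.le, hr.2⟩, neg_add,
      Real.exp_add, ← mul_assoc]

/-! ### Traffic of the devices -/

@[to_additive]
lemma prod_Icc_eq_prod_range {M : Type*} [CommMonoid M] (f : ℕ → M) (n : ℕ) :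
    ∏ k ∈ Finset.Icc 1 n, f k = ∏ k ∈ Finset.range n, f (k + 1) := by
  rw [Finset.range_eq_Ico, Finset.prod_Ico_add' f 0 n 1, zero_add, Finset.Ico_add_one_right_eq_Icc]

/-- Poisson probability that a device generates `L` packets. -/
noncomputable def packetProb (p : Params) (L : ℕ) : ℝ :=
  Real.exp (-p.rate) * p.rate ^ L / (L.factorial : ℝ)

lemma packetProb_nonneg (p : Params) (L : ℕ) : 0 ≤ packetProb p L := by
  have := p.rate_pos
  unfold packetProb
  positivity

lemma hasSum_packetProb (p : Params) : HasSum (packetProb p) 1 := by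
  have h := hasSum_one_poissonMeasure p.rate.toNNReal
  rwa [Real.coe_toNNReal _ p.rate_pos.le] at h

/-- A uniformly random set of `m` among `n` slots contains a given one with probability `m / n`. -/
lemma card_filter_mem_card_eq {n : ℕ} (t : Fin n) (m : ℕ) :
    (((Finset.univ.filter fun S : Finset (Fin n) => t ∈ S).filter fun S => S.card = m).card : ℝ)
      / (n.choose m : ℕ) = if m ≤ n then (m : ℝ) / n else 0 := by
  obtain ⟨N, rfl⟩ : ∃ N, n = N + 1 := ⟨n - 1, by have := t.2; omega⟩
  have h1 : (Finset.univ.filter fun S : Finset (Fin (N + 1)) => S.card = m).card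
      = (N + 1).choose m := by
    rw [← Finset.powerset_univ, ← Finset.powersetCard_eq_filter, Finset.card_powersetCard,
      Finset.card_univ, Fintype.card_fin]
  have h2 : ((Finset.univ.filter fun S : Finset (Fin (N + 1)) => S.card = m).filter
      fun S => t ∉ S).card = N.choose m := by
    have : ((Finset.univ.filter fun S : Finset (Fin (N + 1)) => S.card = m).filter fun S => t ∉ S)
        = Finset.powersetCard m (Finset.univ.erase t) := by
      ext S
      simp [Finset.mem_powersetCard, Finset.subset_erase, and_comm]
    rw [this, Finset.card_powersetCard, Finset.card_erase_of_mem (Finset.mem_univ t),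
      Finset.card_univ, Fintype.card_fin, Nat.add_sub_cancel]
  have h3 := Finset.card_filter_add_card_filter_not
    (s := Finset.univ.filter fun S : Finset (Fin (N + 1)) => S.card = m) (fun S => t ∈ S)
  rw [h1, h2] at h3
  rw [Finset.filter_comm]
  set X := ((Finset.univ.filter fun S : Finset (Fin (N + 1)) => S.card = m).filter
    fun S => t ∈ S).card
  split_ifs with hm
  · have hc : (((N + 1).choose m : ℕ) : ℝ) ≠ 0 := by
      exact_mod_cast (Nat.choose_pos hm).ne'
    rw [div_eq_div_iff hc (by positivity)]
    cases m with
    | zero =>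
      have : X = 0 := by simpa using h3
      simp [this]
    | succ m =>
      have hX : X = N.choose m := by
        have h4 := Nat.choose_succ_succ' N m
        omega
      rw [hX, mul_comm, mul_comm ((m + 1 : ℕ) : ℝ)]
      exact_mod_cast Nat.add_one_mul_choose_eq N m
  · rw [Nat.choose_eq_zero_of_lt (by omega)]
    simp

lemma card_filter_apply_eq {n N : ℕ} (t : Fin n) (c : Fin N) :
    ((Finset.univ.filter fun f : Fin n → Fin N => f t = c).card : ℝ) / (N : ℝ) ^ n
      = 1 / N := by
  have h : (Finset.univ.filter fun f : Fin n → Fin N => f t = c)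
      = Fintype.piFinset fun i => if i = t then {c} else Finset.univ := by
    ext f
    simp only [Finset.mem_filter, Finset.mem_univ, true_and, Fintype.mem_piFinset]
    constructor
    · rintro h i
      split_ifs with hi
      · simp [hi, h]
      · exact Finset.mem_univ _
    · intro h
      simpa using h t
  have hN : (N : ℝ) ≠ 0 := by
    have := c.2
    exact_mod_cast (by omega : N ≠ 0)
  have hcard : (Finset.univ.filter fun f : Fin n → Fin N => f t = c).card * N = N ^ n := by
    rw [h, Fintype.card_piFinset, ← Finset.mul_prod_erase _ _ (Finset.mem_univ t),
      Finset.prod_congr rfl (g := fun _ => N) fun i hi => ?_]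
    · simp only [if_true, Finset.card_singleton, one_mul, Finset.prod_const,
        Finset.card_erase_of_mem (Finset.mem_univ t), Finset.card_univ, Fintype.card_fin]
      rw [← pow_succ, Nat.sub_add_cancel (by have := t.2; omega)]
    · rw [if_neg (Finset.ne_of_mem_erase hi), Finset.card_univ, Fintype.card_fin]
  rw [div_eq_div_iff (by positivity) hN, one_mul]
  exact_mod_cast hcard

/-- A device with `L` packets uses a given slot with probability `min L nSlot / nSlot`; averaging over
`L` gives `slotValue`, the two sums of which are the cases `L ≤ nSlot` and `nSlot < L`. -/
lemma hasSum_slotValue (p : Params) :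
    HasSum (fun L => packetProb p L * ((min L p.nSlot : ℕ) / (p.nSlot : ℝ))) (slotValue p) := by
  have hn : (p.nSlot : ℝ) ≠ 0 := by exact_mod_cast p.nSlot_pos.ne'
  have hsum : Summable fun L => packetProb p L * ((min L p.nSlot : ℕ) / (p.nSlot : ℝ)) := by
    refine (hasSum_packetProb p).summable.of_nonneg_of_le
      (fun L => mul_nonneg (packetProb_nonneg p L) (by positivity)) fun L => ?_
    refine mul_le_of_le_one_right (packetProb_nonneg p L) ?_
    rw [div_le_one (by exact_mod_cast p.nSlot_pos)]
    exact_mod_cast min_le_right _ _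
  convert hsum.hasSum using 1
  rw [← hsum.sum_add_tsum_nat_add (p.nSlot + 1), slotValue]
  congr 1
  · rw [Finset.sum_range_succ', sum_Icc_eq_sum_range]
    simp only [Nat.zero_min, Nat.cast_zero, zero_div, mul_zero, add_zero, Nat.add_sub_cancel]
    refine Finset.sum_congr rfl fun i hi => ?_
    rw [min_eq_left (by simpa using hi), packetProb, Nat.factorial_succ]
    push_cast
    field_simp
  · congr 1 with i
    rw [min_eq_right (by omega), div_self hn, mul_one, packetProb, add_comm i]

lemma slotValue_pos (p : Params) : 0 < slotValue p := by
  have h := p.rate_pos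
  have hn := p.nSlot_pos
  rw [← (hasSum_slotValue p).tsum_eq]
  refine (hasSum_slotValue p).summable.tsum_pos
    (fun L => mul_nonneg (packetProb_nonneg p L) (by positivity)) 1 ?_
  have : min 1 p.nSlot = 1 := min_eq_left hn
  rw [this]
  unfold packetProb
  positivity

/-- Binomial theorem: the number of other devices in the slot is binomial, and each of them misses a
given code with probability `(nCode - 1) / nCode`. -/
lemma collisionFreeValue_eq (p : Params) :
    collisionFreeValue p = (1 - slotValue p / p.nCode) ^ (p.nAct - 1) := by
  have hn : (p.nCode : ℝ) ≠ 0 := by exact_mod_cast p.nCode_pos.ne'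
  have h : 1 - slotValue p / p.nCode
      = slotValue p * (((p.nCode : ℝ) - 1) / p.nCode) + (1 - slotValue p) := by
    field_simp
    ring
  rw [h, add_pow, collisionFreeValue, Finset.sum_range_succ', sum_Icc_eq_sum_range, add_comm]
  congr 1
  · refine Finset.sum_congr rfl fun n _ => ?_
    rw [mul_pow, Nat.sub_right_comm]
    ring
  · simp

namespace Frame

variable {p : Params} {Ω : Type*} {F : Frame p Ω} [MeasurableSpace Ω] {P : Measure Ω}

/-- Joint law of the number of packets, the slots and the codes of a device. -/
lemma IsModel.measure_record (hF : F.IsModel P) (m : Fin p.nAct) (L : ℕ)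
    (A : Finset (Finset (Fin p.nSlot))) (C : Finset (Fin p.nSlot → Fin p.nCode)) :
    P {ω | (F.device m ω).packets = L ∧ (F.device m ω).slots ∈ A ∧ (F.device m ω).code ∈ C}
      = ENNReal.ofReal (packetProb p L
        * (((A.filter fun S => S.card = min L p.nSlot).card : ℝ)
            / (p.nSlot.choose (min L p.nSlot) : ℕ))
        * (C.card / (p.nCode : ℝ) ^ p.nSlot)) := by
  let e : Finset (Fin p.nSlot) × (Fin p.nSlot → Fin p.nCode) ↪ DeviceRecord p :=
    ⟨fun z => ⟨L, z.1, z.2⟩, fun z w h => by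
      simp only [DeviceRecord.mk.injEq, true_and] at h
      exact Prod.ext h.1 h.2⟩
  have hset : {ω | (F.device m ω).packets = L ∧ (F.device m ω).slots ∈ A
      ∧ (F.device m ω).code ∈ C} = F.device m ⁻¹' ↑((A ×ˢ C).map e) := by
    ext ω
    simp only [Set.mem_ofPred_eq, Set.mem_preimage, Finset.coe_map, Set.mem_image,
      Finset.mem_coe, Finset.mem_product, Prod.exists]
    constructor
    · rintro ⟨h1, h2, h3⟩
      exact ⟨_, _, ⟨h2, h3⟩, by subst h1; rfl⟩
    · rintro ⟨S, f, ⟨h2, h3⟩, h⟩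
      rw [← h]
      exact ⟨rfl, h2, h3⟩
  have hrec : ∀ d, 0 ≤ recordProb p d := by
    intro d
    have := p.rate_pos
    unfold recordProb
    split_ifs <;> positivity
  have hlaw : ∀ z, P (F.device m ⁻¹' {e z}) = ENNReal.ofReal (recordProb p (e z)) :=
    fun z => hF.law_device m (e z)
  rw [hset, ← sum_measure_preimage_singleton _ fun d _ => hF.measurable_device m trivial,
    Finset.sum_map,
    Finset.sum_congr rfl fun z _ => hlaw z,
    ← ENNReal.ofReal_sum_of_nonneg fun z _ => hrec _, Finset.sum_product]
  have hval : ∀ S f, recordProb p (e (S, f)) = if S.card = min L p.nSlot then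
      packetProb p L * (1 / ((p.nSlot.choose (min L p.nSlot) : ℕ) : ℝ))
        * (1 / (p.nCode : ℝ)) ^ p.nSlot else 0 := fun _ _ => rfl
  congr 1
  simp only [hval, Finset.sum_const, nsmul_eq_mul, ← Finset.mul_sum, ← Finset.sum_filter]
  rw [one_div_pow]
  ring

lemma IsModel.map_packets [IsProbabilityMeasure P] (hF : F.IsModel P) (m : Fin p.nAct) :
    P.map (fun ω => (F.device m ω).packets) = poissonMeasure p.rate.toNNReal := by
  have hmeas : Measurable fun ω => (F.device m ω).packets :=
    (measurable_from_top (f := DeviceRecord.packets)).comp (hF.measurable_device m)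
  refine Measure.ext_of_singleton fun L => ?_
  rw [Measure.map_apply hmeas (measurableSet_singleton L), poissonMeasure_singleton,
    Real.coe_toNNReal _ p.rate_pos.le]
  have h := hF.measure_record m L Finset.univ Finset.univ
  simp only [Finset.mem_univ, and_true] at h
  have h1 : (Finset.univ.filter fun S : Finset (Fin p.nSlot) => S.card = min L p.nSlot).card
      = p.nSlot.choose (min L p.nSlot) := by
    rw [← Finset.powerset_univ, ← Finset.powersetCard_eq_filter, Finset.card_powersetCard,
      Finset.card_univ, Fintype.card_fin]
  have h2 : ((p.nSlot.choose (min L p.nSlot) : ℕ) : ℝ) ≠ 0 := by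
    exact_mod_cast (Nat.choose_pos (min_le_right _ _)).ne'
  have h3 : ((p.nCode : ℝ) ^ p.nSlot) ≠ 0 :=
    pow_ne_zero _ (by exact_mod_cast p.nCode_pos.ne')
  rw [h1, div_self h2, Finset.card_univ, Fintype.card_fun, Fintype.card_fin, Fintype.card_fin,
    Nat.cast_pow, div_self h3, mul_one, mul_one] at h
  exact h

lemma IsModel.integral_numPackets [IsProbabilityMeasure P] (hF : F.IsModel P) :
    ∫ ω, F.numPackets ω ∂P = p.nAct * p.rate := by
  have hmeas : ∀ m, Measurable fun ω => (F.device m ω).packets := fun m =>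
    (measurable_from_top (f := DeviceRecord.packets)).comp (hF.measurable_device m)
  have hint : ∀ m, ∫ ω, ((F.device m ω).packets : ℝ) ∂P = p.rate := by
    intro m
    rw [← integral_map (f := fun n : ℕ => (n : ℝ)) (hmeas m).aemeasurable
      Measurable.of_discrete.aestronglyMeasurable, hF.map_packets, integral_natCast_poissonMeasure,
      Real.coe_toNNReal _ p.rate_pos.le]
  have hi : ∀ m, Integrable (fun ω => ((F.device m ω).packets : ℝ)) P := fun m =>
    Integrable.of_integral_ne_zero (by rw [hint]; exact p.rate_pos.ne')
  unfold numPackets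
  rw [integral_finsetSum _ fun m _ => hi m]
  simp [hint]

/-- The records that use slot `t` with the code `c`. -/
def usesCode (t : Fin p.nSlot) (c : Fin p.nCode) : Set (DeviceRecord p) :=
  {d | t ∈ d.slots ∧ d.code t = c}

/-- The code is uniform and independent of the use of the slot. -/
lemma IsModel.real_usesCode (hF : F.IsModel P) (m : Fin p.nAct) (t : Fin p.nSlot)
    (c : Fin p.nCode) : P.real (F.device m ⁻¹' usesCode t c) = slotValue p / p.nCode := by
  have hunion : F.device m ⁻¹' usesCode t c = ⋃ L, {ω | (F.device m ω).packets = L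
      ∧ (F.device m ω).slots ∈ (Finset.univ.filter fun S : Finset (Fin p.nSlot) => t ∈ S)
      ∧ (F.device m ω).code ∈ (Finset.univ.filter fun f : Fin p.nSlot → Fin p.nCode => f t = c)} := by
    ext ω
    simp [usesCode]
  have hs := (hasSum_slotValue p).div_const (p.nCode : ℝ)
  have h0 : 0 ≤ slotValue p / p.nCode := div_nonneg (slotValue_pos p).le (by positivity)
  rw [measureReal_def, hunion, measure_iUnion]
  · simp_rw [hF.measure_record, card_filter_mem_card_eq, card_filter_apply_eq,
      if_pos (min_le_right _ p.nSlot), mul_one_div]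
    rw [← ENNReal.ofReal_tsum_of_nonneg (fun L => div_nonneg
      (mul_nonneg (packetProb_nonneg p L) (by positivity)) (by positivity)) hs.summable,
      hs.tsum_eq, ENNReal.toReal_ofReal h0]
  · intro L L' hL
    rw [Function.onFun, Set.disjoint_left]
    rintro ω ⟨h1, -⟩ ⟨h2, -⟩
    exact hL (h1.symm.trans h2)
  · intro L
    exact hF.measurable_device m
      (show MeasurableSet {d : DeviceRecord p | d.packets = L ∧ d.slots ∈ _ ∧ d.code ∈ _}
        from trivial)

lemma IsModel.real_active [IsProbabilityMeasure P] (hF : F.IsModel P) (m : Fin p.nAct)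
    (t : Fin p.nSlot) : P.real (F.active m t) = slotValue p := by
  have hunion : F.active m t = ⋃ c, F.device m ⁻¹' usesCode t c := by
    ext ω
    simp [usesCode, active]
  have hn : (p.nCode : ℝ) ≠ 0 := by exact_mod_cast p.nCode_pos.ne'
  rw [hunion, measureReal_iUnion_fintype]
  · simp_rw [hF.real_usesCode]
    simp
    field_simp
  · intro c c' hc
    rw [Function.onFun, Set.disjoint_left]
    rintro ω ⟨-, h1⟩ ⟨-, h2⟩
    exact hc (h1.symm.trans h2)
  · exact fun c => hF.measurable_device m trivial

/-- Given the slot usage and the code `c` of one device, each of the others independently avoids the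
pair of slot and code with probability `1 - slotValue / nCode`, whatever `c` is. -/
lemma IsModel.real_active_inter_collisionFree [IsProbabilityMeasure P] (hF : F.IsModel P)
    (m : Fin p.nAct) (t : Fin p.nSlot) : P.real (F.active m t ∩ F.collisionFree m t)
      = slotValue p * (1 - slotValue p / p.nCode) ^ (p.nAct - 1) := by
  classical
  let D : Fin p.nCode → Fin p.nAct → Set (DeviceRecord p) := fun c m' =>
    if m' = m then usesCode t c else (usesCode t c)ᶜ
  have hunion : F.active m t ∩ F.collisionFree m t
      = ⋃ c, ⋂ m' ∈ Finset.univ, F.device m' ⁻¹' D c m' := by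
    ext ω
    simp only [Set.mem_inter_iff, Set.mem_iUnion, Set.mem_iInter, Finset.mem_univ, true_implies,
      active, collisionFree, Set.mem_ofPred_eq, Set.mem_preimage, D]
    constructor
    · rintro ⟨h1, h2⟩
      refine ⟨(F.device m ω).code t, fun m' => ?_⟩
      split_ifs with hm
      · subst hm
        exact ⟨h1, rfl⟩
      · exact fun h => h2 m' hm h.1 h.2
    · rintro ⟨c, h⟩
      have hm := h m
      rw [if_pos rfl] at hm
      refine ⟨hm.1, fun m' hne ht hc => ?_⟩
      have hm' := h m'
      rw [if_neg hne] at hm'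
      exact hm' ⟨ht, hc.trans hm.2⟩
  have hn : (p.nCode : ℝ) ≠ 0 := by exact_mod_cast p.nCode_pos.ne'
  have hterm : ∀ c, P.real (⋂ m' ∈ Finset.univ, F.device m' ⁻¹' D c m')
      = slotValue p / p.nCode * (1 - slotValue p / p.nCode) ^ (p.nAct - 1) := by
    intro c
    rw [measureReal_def, hF.indep_device.measure_inter_preimage_eq_mul Finset.univ
      (fun m' _ => trivial), ENNReal.toReal_prod,
      ← Finset.mul_prod_erase _ _ (Finset.mem_univ m),
      Finset.prod_congr rfl (g := fun _ => 1 - slotValue p / p.nCode) fun m' hm' => ?_,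
      Finset.prod_const, Finset.card_erase_of_mem (Finset.mem_univ m), Finset.card_univ,
      Fintype.card_fin]
    · congr 1
      simp only [D, if_true]
      exact hF.real_usesCode m t c
    · simp only [D, if_neg (Finset.ne_of_mem_erase hm')]
      rw [Set.preimage_compl, ← measureReal_def, probReal_compl_eq_one_sub
        (hF.measurable_device m' trivial), hF.real_usesCode]
  rw [hunion, measureReal_iUnion_fintype]
  · simp_rw [hterm]
    simp
    field_simp
  · intro c c' hc
    rw [Function.onFun, Set.disjoint_left]
    intro ω h1 h2
    have h1' := Set.mem_iInter₂.1 h1 m (Finset.mem_univ m)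
    have h2' := Set.mem_iInter₂.1 h2 m (Finset.mem_univ m)
    simp only [D, if_true] at h1' h2'
    exact hc (h1'.2.symm.trans h2'.2)
  · exact fun c => Finset.measurableSet_biInter _ fun m' _ => hF.measurable_device m' trivial

theorem IsModel.collisionFreeProb_eq [IsProbabilityMeasure P] (hF : F.IsModel P) (t : Fin p.nSlot) :
    F.collisionFreeProb P t = collisionFreeValue p := by
  have hmeas : MeasurableSet (F.active ⟨0, p.nAct_pos⟩ t) :=
    hF.measurable_device _ (show MeasurableSet {d : DeviceRecord p | t ∈ d.slots} from trivial)
  rw [collisionFreeProb, measureReal_def, cond_apply hmeas,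
    ENNReal.toReal_mul, ENNReal.toReal_inv, ← measureReal_def, ← measureReal_def,
    hF.real_active, hF.real_active_inter_collisionFree, collisionFreeValue_eq,
    inv_mul_cancel_left₀ (slotValue_pos p).ne']

end Frame

/-! ### Successive decoding and the frame average -/

/-- Probability that the SINR of the `j`-th singleton device exceeds the threshold, counted from
`j = 1`. -/
noncomputable def exceedsValue (p : Params) (j : ℕ) : ℝ :=
  ∫ r in (0 : ℝ)..p.radius,
    Real.exp (-(laplaceArg p r * p.noise))
    * Real.exp (-(2 * Real.pi * p.dens * collisionFreeValue p
        * interferenceIntegral p (laplaceArg p r) r))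
    * Real.exp (-(2 * Real.pi * p.dens * (1 - collisionFreeValue p)
        * interferenceIntegral p (laplaceArg p r) 0))
    * orderedDistDensity p j r

namespace Frame

variable {p : Params} {Ω : Type*} {F : Frame p Ω}

lemma covered_eq_biInter (t : Fin p.nSlot) (k : Fin p.nSing) :
    F.covered t k = ⋂ j ∈ Finset.Iic k, F.exceeds t j := by
  ext ω
  simp [covered]

variable [MeasurableSpace Ω] {P : Measure Ω}

lemma IsModel.measurableSet_covered (hF : F.IsModel P) (t : Fin p.nSlot) (k : Fin p.nSing) :
    MeasurableSet (F.covered t k) := by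
  rw [covered_eq_biInter]
  exact Finset.measurableSet_biInter _ fun j _ => hF.measurableSet_exceeds t j

variable [IsProbabilityMeasure P]

/-- The `k`-th device counts from `0` and the density from `1`, hence the shift. -/
lemma IsModel.real_covered (hF : F.IsModel P) (t : Fin p.nSlot) (k : Fin p.nSing) :
    P.real (F.covered t k) = ∏ j ∈ Finset.Icc 1 ((k : ℕ) + 1), exceedsValue p j := by
  have h : ∀ j, P.real (F.exceeds t j) = exceedsValue p (j + 1) := by
    intro j
    rw [hF.real_exceeds, hF.collisionFreeProb_eq]
    rfl
  rw [covered_eq_biInter, measureReal_def, (hF.indep_exceeds t).meas_biInter, ENNReal.toReal_prod,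
    prod_Icc_eq_prod_range]
  simp_rw [← measureReal_def, h]
  rw [Nat.range_succ_eq_Iic, ← Fin.map_valEmbedding_Iic, Finset.prod_map]
  rfl

lemma IsModel.integral_numCovered (hF : F.IsModel P) :
    ∫ ω, F.numCovered ω ∂P
      = p.nSlot * ∑ k ∈ Finset.Icc 1 p.nSing, ∏ j ∈ Finset.Icc 1 k, exceedsValue p j := by
  have hi : ∀ t k, Integrable ((F.covered t k).indicator fun _ => (1 : ℝ)) P := fun t k =>
    (integrable_const 1).indicator (hF.measurableSet_covered t k)
  have h1 : ∀ t k, ∫ ω, (F.covered t k).indicator (fun _ => (1 : ℝ)) ω ∂P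
      = ∏ j ∈ Finset.Icc 1 ((k : ℕ) + 1), exceedsValue p j := by
    intro t k
    rw [integral_indicator_const _ (hF.measurableSet_covered t k), smul_eq_mul, mul_one,
      hF.real_covered]
  unfold numCovered
  rw [integral_finsetSum _ fun t _ => integrable_finsetSum _ fun k _ => hi t k]
  simp_rw [integral_finsetSum _ fun k _ => hi _ k, h1]
  rw [Finset.sum_const, Finset.card_univ, Fintype.card_fin, nsmul_eq_mul, sum_Icc_eq_sum_range,
    Finset.sum_range]

end Frame

end MusaUplink

theorem theorem1 (p : Params) {Ω : Type*} [MeasurableSpace Ω] (P : Measure Ω)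
    [IsProbabilityMeasure P] (F : Frame p Ω) (hF : F.IsModel P) :
    F.coverageProb P =
      ∑ k ∈ Finset.Icc 1 p.nSing, (p.nSlot : ℝ) / ((p.nAct : ℝ) * p.rate) *
        ∏ j ∈ Finset.Icc 1 k, ∫ r in (0 : ℝ)..p.radius,
          Real.exp (-(laplaceArg p r * p.noise))
          * Real.exp (-(2 * Real.pi * p.dens * collisionFreeValue p
              * interferenceIntegral p (laplaceArg p r) r))
          * Real.exp (-(2 * Real.pi * p.dens * (1 - collisionFreeValue p)
              * interferenceIntegral p (laplaceArg p r) 0))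
          * ((p.nSing.factorial : ℝ) / (((j - 1).factorial : ℝ) * ((p.nSing - j).factorial : ℝ)))
          * (2 * r ^ (2 * j - 1) / p.radius ^ (2 * j))
          * (1 - r ^ 2 / p.radius ^ 2) ^ (p.nSing - j) := by
  have hterm : ∀ j, exceedsValue p j = ∫ r in (0 : ℝ)..p.radius,
          Real.exp (-(laplaceArg p r * p.noise))
          * Real.exp (-(2 * Real.pi * p.dens * collisionFreeValue p
              * interferenceIntegral p (laplaceArg p r) r))
          * Real.exp (-(2 * Real.pi * p.dens * (1 - collisionFreeValue p)
              * interferenceIntegral p (laplaceArg p r) 0))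
          * ((p.nSing.factorial : ℝ) / (((j - 1).factorial : ℝ) * ((p.nSing - j).factorial : ℝ)))
          * (2 * r ^ (2 * j - 1) / p.radius ^ (2 * j))
          * (1 - r ^ 2 / p.radius ^ 2) ^ (p.nSing - j) := by
    intro j
    simp only [exceedsValue, orderedDistDensity, mul_assoc]
  simp_rw [← hterm]
  rw [Frame.coverageProb, hF.integral_numCovered, hF.integral_numPackets, ← Finset.mul_sum,
    mul_div_right_comm]
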